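/- Let $(M,J)$ be a compact connected complex manifold of complex dimension $n\ge 2$, and let $g$ be a smooth Riemannian metric on $M$ such that $(M,g,J)$ is locally conformally Kähler (lcK): $g$ is Hermitian, $g(J\cdot,J\cdot)=g$, and every point of $M$ has an open neighbourhood $U$ with a smooth function $\varphi:U\to\mathbb R$ such that $e^{-2\varphi}g$ is a Kähler metric on $(U,J)$. Put $\Omega=g(J\cdot,\cdot)$. The Lee form $\theta$ of $(M,g,J)$ is the closed $1$-form on $M$ characterised by $d\Omega=2\,\theta\wedge\Omega$. Assume that $g$ is Einstein, i.e. $\mathrm{Ric}_g=\lambda g$ for some constant $\lambda\in\mathbb R$, and that its scalar curvature is non-positive. Then $\theta\equiv 0$. Consequently $d\Omega=0$, and $(M,g,J)$ is a Kähler–Einstein manifold. -/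

import Mathlib

set_option maxSynthPendingDepth 3

open scoped Manifold ContDiff Bundle

noncomputable section

namespace LcK

section Model

variable {E : Type*} [NormedAddCommGroup E] [NormedSpace ℝ E]

/-- The first-kind Christoffel symbols, without the factor `1/2`, of a metric `G` on an open subset
of a vector space:
`koszul G y u v w = (∂_u G)(v, w) + (∂_v G)(u, w) - (∂_w G)(u, v)` at `y`
(see `koszul_apply`). -/
def koszul (G : E → E →L[ℝ] E →L[ℝ] ℝ) (y : E) : E →L[ℝ] E →L[ℝ] E →L[ℝ] ℝ :=
  fderiv ℝ G y + (fderiv ℝ G y).flip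
    - (ContinuousLinearMap.flipₗᵢ ℝ E E ℝ : (E →L[ℝ] E →L[ℝ] ℝ) →L[ℝ] (E →L[ℝ] E →L[ℝ] ℝ)) ∘L
        (fderiv ℝ G y).flip

theorem koszul_apply (G : E → E →L[ℝ] E →L[ℝ] ℝ) (y u v w : E) :
    koszul G y u v w = fderiv ℝ G y u v w + fderiv ℝ G y v u w - fderiv ℝ G y w u v := by
  simp [koszul]

/-- The Christoffel symbols of the Levi-Civita connection of the metric `G` at the point `y`,
as a bilinear map: `Γ(u, v)` is the vector with
`2 G(Γ(u, v), w) = (∂_u G)(v, w) + (∂_v G)(u, w) - (∂_w G)(u, v)` for all `w`.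
For constant vector fields `u`, `v` this is `∇_u v`. -/
def christoffel (G : E → E →L[ℝ] E →L[ℝ] ℝ) (y : E) : E →L[ℝ] E →L[ℝ] E :=
  ContinuousLinearMap.compL ℝ E (E →L[ℝ] ℝ) E (G y).inverse ∘L ((1 / 2 : ℝ) • koszul G y)

/-- The Riemann curvature `R(u, v) w = ∇_u ∇_v w - ∇_v ∇_u w` (constant `u`, `v`, `w`) of the metric
`G` at the point `y`, as a linear map in `u`. -/
def curvature (G : E → E →L[ℝ] E →L[ℝ] ℝ) (y v w : E) : E →ₗ[ℝ] E where
  toFun u :=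
    fderiv ℝ (christoffel G) y u v w - fderiv ℝ (christoffel G) y v u w
      + christoffel G y u (christoffel G y v w) - christoffel G y v (christoffel G y u w)
  map_add' a b := by simp; abel
  map_smul' c a := by simp [smul_sub, smul_add]

/-- The Ricci tensor `Ric(v, w) = tr (u ↦ R(u, v) w)` of the metric `G` at the point `y`. -/
def ricci (G : E → E →L[ℝ] E →L[ℝ] ℝ) (y : E) : E →ₗ[ℝ] E →ₗ[ℝ] ℝ :=
  LinearMap.mk₂ ℝ (fun v w => LinearMap.trace ℝ E (curvature G y v w))
    (fun a b w => by
      rw [← map_add]; congr 1; ext u; simp [curvature]; abel)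
    (fun c a w => by
      rw [← map_smul]; congr 1; ext u; simp [curvature, smul_sub, smul_add])
    (fun v a b => by
      rw [← map_add]; congr 1; ext u; simp [curvature]; abel)
    (fun c v a => by
      rw [← map_smul]; congr 1; ext u; simp [curvature, smul_sub, smul_add])

/-- The scalar curvature of the metric `G` at the point `y`: the trace of the Ricci tensor,
converted into an endomorphism by means of `G`. -/
def scalar [FiniteDimensional ℝ E] (G : E → E →L[ℝ] E →L[ℝ] ℝ) (y : E) : ℝ :=
  LinearMap.trace ℝ E
    ((G y).inverse.toLinearMap ∘ₗ (LinearMap.toContinuousLinearMap (𝕜 := ℝ) (E := E) (F' := ℝ)) ∘ₗ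
      ricci G y)

end Model

section Manifold

variable {E : Type*} [NormedAddCommGroup E] [NormedSpace ℂ E]

/-- The smooth (indeed real analytic) manifold underlying a complex manifold. -/
instance isManifold_real {M : Type*} [TopologicalSpace M] [ChartedSpace E M] {n : ℕ∞ω}
    [IsManifold 𝓘(ℂ, E) n M] : IsManifold 𝓘(ℝ, E) n M := by
  apply isManifold_of_contDiffOn
  intro e e' he he'
  have h := ((contDiffGroupoid n 𝓘(ℂ, E)).compatible he he').1
  exact ContDiffOn.restrict_scalars ℝ h

variable {M : Type*} [TopologicalSpace M] [ChartedSpace E M]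

/-- The complex structure `J` of a complex manifold `M`: multiplication by `i` on `T_x M`. The
tangent space at `x` is represented by `E` through the preferred holomorphic chart at `x`; as
holomorphic coordinate changes have complex linear derivatives, the choice of chart is immaterial. -/
def J (x : M) : TangentSpace 𝓘(ℝ, E) x →L[ℝ] TangentSpace 𝓘(ℝ, E) x :=
  (Complex.I • ContinuousLinearMap.id ℝ E : E →L[ℝ] E)

/-- The expression in the chart `e` of a field `h` of bilinear forms on the tangent spaces of `M`. -/
def formInChart (h : ∀ x : M, TangentSpace 𝓘(ℝ, E) x →L[ℝ] TangentSpace 𝓘(ℝ, E) x →L[ℝ] ℝ)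
    (e : OpenPartialHomeomorph M E) (y : E) : E →L[ℝ] E →L[ℝ] ℝ :=
  let A : E →L[ℝ] E := mfderiv 𝓘(ℝ, E) 𝓘(ℝ, E) e.symm y
  let b : E →L[ℝ] E →L[ℝ] ℝ := h (e.symm y)
  b.bilinearComp A A

theorem formInChart_apply
    (h : ∀ x : M, TangentSpace 𝓘(ℝ, E) x →L[ℝ] TangentSpace 𝓘(ℝ, E) x →L[ℝ] ℝ)
    (e : OpenPartialHomeomorph M E) (y u v : E) :
    formInChart h e y u v = h (e.symm y) (mfderiv 𝓘(ℝ, E) 𝓘(ℝ, E) e.symm y u)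
      (mfderiv 𝓘(ℝ, E) 𝓘(ℝ, E) e.symm y v) := rfl

theorem J_apply (x : M) (v : E) : J (E := E) x v = (Complex.I • v : E) := rfl

/-- The expression in the chart `e` of a 1-form `θ` on `M`. -/
def oneFormInChart (θ : ∀ x : M, TangentSpace 𝓘(ℝ, E) x →L[ℝ] ℝ)
    (e : OpenPartialHomeomorph M E) (y : E) : E →L[ℝ] ℝ :=
  (θ (e.symm y)).comp (mfderiv 𝓘(ℝ, E) 𝓘(ℝ, E) e.symm y)

/-- The 2-form `Ω = h(J·, ·)` associated with a field `h` of bilinear forms. -/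
def fundamentalForm (h : ∀ x : M, TangentSpace 𝓘(ℝ, E) x →L[ℝ] TangentSpace 𝓘(ℝ, E) x →L[ℝ] ℝ)
    (x : M) : TangentSpace 𝓘(ℝ, E) x →L[ℝ] TangentSpace 𝓘(ℝ, E) x →L[ℝ] ℝ :=
  (h x).comp (J x)

/-- The value `(dβ)(u, v, w)` at `y` of the exterior derivative of a 2-form `β` defined on an open
subset of `E`. -/
def extDerivTwo (β : E → E →L[ℝ] E →L[ℝ] ℝ) (y u v w : E) : ℝ :=
  fderiv ℝ β y u v w + fderiv ℝ β y v w u + fderiv ℝ β y w u v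

/-- The value `(α ∧ β)(u, v, w)` of the wedge product of a 1-form and a 2-form on `E`. -/
def wedgeOneTwo (α : E →L[ℝ] ℝ) (β : E →L[ℝ] E →L[ℝ] ℝ) (u v w : E) : ℝ :=
  α u * β v w + α v * β w u + α w * β u v

/-- The field `h` of bilinear forms is `J`-invariant on `U`: `h(J·, J·) = h`. For a Riemannian
metric, this is the definition of a Hermitian metric. -/
def IsHermitianOn (h : ∀ x : M, TangentSpace 𝓘(ℝ, E) x →L[ℝ] TangentSpace 𝓘(ℝ, E) x →L[ℝ] ℝ)
    (U : Set M) : Prop :=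
  ∀ x ∈ U, ∀ v w : TangentSpace 𝓘(ℝ, E) x, h x (J x v) (J x w) = h x v w

/-- A Riemannian metric `h` on the open subset `U` of the complex manifold `M` is Kähler: it is
Hermitian, and its fundamental 2-form `h(J·, ·)` is closed. -/
structure IsKahlerOn
    (h : ∀ x : M, TangentSpace 𝓘(ℝ, E) x →L[ℝ] TangentSpace 𝓘(ℝ, E) x →L[ℝ] ℝ)
    (U : Set M) : Prop where
  hermitian : IsHermitianOn h U
  closed : ∀ e ∈ atlas E M, ∀ y ∈ e.target, e.symm y ∈ U →
    ∀ u v w : E, extDerivTwo (formInChart (fundamentalForm h) e) y u v w = 0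

variable [IsManifold 𝓘(ℂ, E) ω M]

variable (E M) in
/-- Smooth Riemannian metrics on (the smooth manifold underlying) `M`. -/
abbrev Metric := Bundle.ContMDiffRiemannianMetric 𝓘(ℝ, E) ∞ E
  (fun x : M => TangentSpace 𝓘(ℝ, E) x)

/-- `(M, g, J)` is Kähler. -/
def IsKahler (g : Metric E M) : Prop := IsKahlerOn g.inner Set.univ

/-- `(M, g, J)` is locally conformally Kähler: `g` is Hermitian and every point has an open
neighbourhood `U` with a smooth function `φ` on `U` such that `e^{-2φ} g` is Kähler on `U`. -/
structure IsLcK (g : Metric E M) : Prop where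
  hermitian : IsHermitianOn g.inner Set.univ
  locally_conformal : ∀ x : M, ∃ U : Set M, IsOpen U ∧ x ∈ U ∧ ∃ φ : M → ℝ,
    ContMDiffOn 𝓘(ℝ, E) 𝓘(ℝ, ℝ) ∞ φ U ∧
      IsKahlerOn (fun z => Real.exp (-2 * φ z) • g.inner z) U

/-- `θ` is a Lee form of `(M, g, J)`: a smooth closed 1-form with `dΩ = 2 θ ∧ Ω`, where
`Ω = g(J·, ·)`. -/
structure IsLeeForm (g : Metric E M) (θ : ∀ x : M, TangentSpace 𝓘(ℝ, E) x →L[ℝ] ℝ) : Prop where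
  smooth : ∀ e ∈ atlas E M, ContDiffOn ℝ ∞ (oneFormInChart θ e) e.target
  closed : ∀ e ∈ atlas E M, ∀ y ∈ e.target, ∀ u v : E,
    fderiv ℝ (oneFormInChart θ e) y u v - fderiv ℝ (oneFormInChart θ e) y v u = 0
  extDeriv_eq : ∀ e ∈ atlas E M, ∀ y ∈ e.target, ∀ u v w : E,
    extDerivTwo (formInChart (fundamentalForm g.inner) e) y u v w =
      2 * wedgeOneTwo (oneFormInChart θ e y) (formInChart (fundamentalForm g.inner) e y) u v w

/-- The metric `g` is Einstein: `Ric = c g` for a constant `c`. -/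
def IsEinstein (g : Metric E M) : Prop :=
  ∃ c : ℝ, ∀ e ∈ atlas E M, ∀ y ∈ e.target, ∀ v w : E,
    ricci (formInChart g.inner e) y v w = c * formInChart g.inner e y v w

/-- The scalar curvature of `g` at the point `x`, computed in the preferred chart at `x`. -/
def scalarCurvature [FiniteDimensional ℂ E] (g : Metric E M) (x : M) : ℝ :=
  scalar (formInChart g.inner (chartAt E x)) (chartAt E x x)

end Manifold

end LcK

end

/-!
The idea is to find a first-order differential equation for one scalar function, and to conclude
with the divergence theorem.

Locally the Lee form is `θ = df`, where `K = e^{-2f} g` is Kähler. Let `N` be the real dimension,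
`c` the Einstein constant, `X` the vector field dual to `θ`, and let `∇` and `Ric^K` belong to `K`.
By the conformal change formula (`IsMetricOn.ricci_conformal`),

  `Ric_g = Ric^K - (N - 2) (g(∇X, ·) + θ ⊗ θ) - (div X) g`.

The Ricci tensor of a Kähler metric is `J`-invariant, and so is `Ric_g = c g`. Hence the covariant
derivative `∇V` of `V = e^f X`, which is dual to `e^f (g(∇X, ·) + θ ⊗ θ)`, is symmetric and commutes
with `J`. For such a field, comparing the traces of the Ricci identity in the directions `z` and
`J z` gives `d (tr ∇V) = -2 Ric^K(·, V)` (`IsKahlerMetricOn.fderiv_divergence`). Rewritten in terms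
of `g`, this says that `P = |θ|² - div X` satisfies

  `dP = -(3 P - 2 c + (N - 4) |θ|²) θ`    (`fderiv_normSq_sub_divergence`).

Write `F = |θ|²` and `p = max P 0`. As `div X = F - P`, the equation gives

  `-div (p² X) = p³ + 5 p² F - 4 c p F + 2 (N - 4) p F²`,

where each term is nonnegative since `c ≤ 0` and `N ≥ 4`. On a compact manifold a vector field whose
divergence has a constant sign is divergence-free (`mdivergence_eq_zero_of_nonneg`), so `P ≤ 0`.
Then `div X = F - P ≥ F ≥ 0`, and the same principle yields `F = 0`, that is `θ = 0`.

The divergence theorem is proved with a finite smooth partition of unity, integration by parts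
against the density `√(det g)` in each chart, and the change of variables formula. The Lee form
exists globally, and is unique, since in complex dimension at least two the wedge product with the
fundamental form is injective on 1-forms (`eq_zero_of_wedge_eq_zero`).
-/

noncomputable section

namespace LcK

/-! ### The Levi-Civita connection and its curvature on an open subset of a vector space -/

section LocalGeometry

variable {E : Type*} [NormedAddCommGroup E] [NormedSpace ℝ E]

/-- `G` is a smooth Riemannian metric on the open subset `W` of the vector space `E`. -/
structure IsMetricOn (G : E → E →L[ℝ] E →L[ℝ] ℝ) (W : Set E) : Prop where
  isOpen : IsOpen W
  contDiffOn : ContDiffOn ℝ ∞ G W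
  symm : ∀ y ∈ W, ∀ v w, G y v w = G y w v
  pos : ∀ y ∈ W, ∀ v, v ≠ 0 → 0 < G y v v

theorem fderiv_clm_apply₁ {F F' : Type*} [NormedAddCommGroup F] [NormedSpace ℝ F]
    [NormedAddCommGroup F'] [NormedSpace ℝ F'] {Φ : E → F →L[ℝ] F'} {y : E}
    (h : DifferentiableAt ℝ Φ y) (v : F) (x : E) :
    fderiv ℝ (fun z => Φ z v) y x = fderiv ℝ Φ y x v := by
  rw [fderiv_clm_apply h (differentiableAt_const v)]
  simp

theorem fderiv_clm_apply₂ {F F' F'' : Type*} [NormedAddCommGroup F] [NormedSpace ℝ F]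
    [NormedAddCommGroup F'] [NormedSpace ℝ F'] [NormedAddCommGroup F''] [NormedSpace ℝ F'']
    {Φ : E → F →L[ℝ] F' →L[ℝ] F''} {y : E}
    (h : DifferentiableAt ℝ Φ y) (v : F) (w : F') (x : E) :
    fderiv ℝ (fun z => Φ z v w) y x = fderiv ℝ Φ y x v w := by
  rw [fderiv_clm_apply₁ (h.clm_apply (differentiableAt_const v)), fderiv_clm_apply₁ h]

/-- Product rule for the application of a bilinear map to two vector fields. -/
theorem fderiv_bilin_apply {F F' F'' : Type*} [NormedAddCommGroup F] [NormedSpace ℝ F]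
    [NormedAddCommGroup F'] [NormedSpace ℝ F'] [NormedAddCommGroup F''] [NormedSpace ℝ F'']
    {Φ : E → F →L[ℝ] F' →L[ℝ] F''} {a : E → F} {b : E → F'} {y : E}
    (h : DifferentiableAt ℝ Φ y) (ha : DifferentiableAt ℝ a y) (hb : DifferentiableAt ℝ b y)
    (x : E) :
    fderiv ℝ (fun z => Φ z (a z) (b z)) y x =
      fderiv ℝ Φ y x (a y) (b y) + Φ y (fderiv ℝ a y x) (b y) + Φ y (a y) (fderiv ℝ b y x) := by
  rw [fderiv_clm_apply (h.clm_apply ha) hb, fderiv_clm_apply h ha]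
  simp only [add_apply, ContinuousLinearMap.comp_apply,
    ContinuousLinearMap.flip_apply]
  abel

theorem isSymmSndFDerivAt {F : Type*} [NormedAddCommGroup F] [NormedSpace ℝ F] {f : E → F} {y : E}
    (hf : ContDiffAt ℝ ∞ f y) : IsSymmSndFDerivAt ℝ f y :=
  hf.isSymmSndFDerivAt (by
    rw [minSmoothness_of_isRCLikeNormedField]
    exact WithTop.coe_le_coe.2 (le_top : (2 : ℕ∞) ≤ ⊤))

namespace IsMetricOn

variable {G : E → E →L[ℝ] E →L[ℝ] ℝ} {W : Set E}

theorem contDiffAt (hG : IsMetricOn G W) {y : E} (hy : y ∈ W) : ContDiffAt ℝ ∞ G y :=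
  hG.contDiffOn.contDiffAt (hG.isOpen.mem_nhds hy)

theorem differentiableAt (hG : IsMetricOn G W) {y : E} (hy : y ∈ W) : DifferentiableAt ℝ G y :=
  (hG.contDiffAt hy).differentiableAt (by simp)

theorem mono (hG : IsMetricOn G W) {W' : Set E} (hW' : IsOpen W') (h : W' ⊆ W) :
    IsMetricOn G W' :=
  ⟨hW', hG.contDiffOn.mono h, fun y hy => hG.symm y (h hy), fun y hy => hG.pos y (h hy)⟩

theorem eq_of_forall (hG : IsMetricOn G W) {y : E} (hy : y ∈ W) {a b : E}
    (h : ∀ w, G y a w = G y b w) : a = b := by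
  by_contra hab
  have := hG.pos y hy (a - b) (sub_ne_zero.2 hab)
  simp [h] at this

theorem contDiffOn_fderiv (hG : IsMetricOn G W) : ContDiffOn ℝ ∞ (fderiv ℝ G) W :=
  hG.contDiffOn.fderiv_of_isOpen hG.isOpen (by simp)

theorem fderiv_symm (hG : IsMetricOn G W) {y : E} (hy : y ∈ W) (x v w : E) :
    fderiv ℝ G y x v w = fderiv ℝ G y x w v := by
  rw [← fderiv_clm_apply₂ (hG.differentiableAt hy), ← fderiv_clm_apply₂ (hG.differentiableAt hy)]
  congr 1
  apply Filter.EventuallyEq.fderiv_eq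
  filter_upwards [hG.isOpen.mem_nhds hy] with z hz using hG.symm z hz v w

theorem fderiv_fderiv_symm (hG : IsMetricOn G W) {y : E} (hy : y ∈ W) (a b v w : E) :
    fderiv ℝ (fderiv ℝ G) y a b v w = fderiv ℝ (fderiv ℝ G) y b a v w := by
  have h : IsSymmSndFDerivAt ℝ G y :=
    (hG.contDiffAt hy).isSymmSndFDerivAt (by
      rw [minSmoothness_of_isRCLikeNormedField]; exact WithTop.coe_le_coe.2 (le_top : (2 : ℕ∞) ≤ ⊤))
  rw [h.eq a b]

variable [FiniteDimensional ℝ E]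

theorem isInvertible (hG : IsMetricOn G W) {y : E} (hy : y ∈ W) : (G y).IsInvertible := by
  have hinj : Function.Injective (G y : E →ₗ[ℝ] (E →L[ℝ] ℝ)) := by
    intro a b hab
    exact hG.eq_of_forall hy fun w => DFunLike.congr_fun hab w
  have hdim : Module.finrank ℝ E = Module.finrank ℝ (E →L[ℝ] ℝ) := by
    rw [← (LinearMap.toContinuousLinearMap (𝕜 := ℝ) (E := E) (F' := ℝ)).finrank_eq,
      Subspace.dual_finrank_eq]
  refine ⟨(LinearEquiv.ofInjectiveOfFinrankEq _ hinj hdim).toContinuousLinearEquiv, ?_⟩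
  ext a b
  rfl

theorem apply_inverse (hG : IsMetricOn G W) {y : E} (hy : y ∈ W) (α : E →L[ℝ] ℝ) :
    G y ((G y).inverse α) = α :=
  (hG.isInvertible hy).self_apply_inverse α

theorem contDiffOn_inverse (hG : IsMetricOn G W) :
    ContDiffOn ℝ ∞ (fun y => (G y).inverse) W := fun y hy =>
  (((hG.isInvertible hy).contDiffAt_map_inverse).comp y (hG.contDiffAt hy)).contDiffWithinAt

theorem two_mul_christoffel (hG : IsMetricOn G W) {y : E} (hy : y ∈ W) (u v w : E) :
    2 * G y (christoffel G y u v) w =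
      fderiv ℝ G y u v w + fderiv ℝ G y v u w - fderiv ℝ G y w u v := by
  have : G y (christoffel G y u v) = (1 / 2 : ℝ) • koszul G y u v := by
    simp only [christoffel, ContinuousLinearMap.comp_apply, ContinuousLinearMap.compL_apply,
      smul_apply, map_smul, hG.apply_inverse hy]
  rw [this, ← koszul_apply]
  simp

theorem christoffel_symm (hG : IsMetricOn G W) {y : E} (hy : y ∈ W) (u v : E) :
    christoffel G y u v = christoffel G y v u := by
  refine hG.eq_of_forall hy fun w => ?_
  have h1 := hG.two_mul_christoffel hy u v w
  have h2 := hG.two_mul_christoffel hy v u w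
  rw [hG.fderiv_symm hy w v u] at h2
  linarith

/-- The Levi-Civita connection is metric. -/
theorem fderiv_eq (hG : IsMetricOn G W) {y : E} (hy : y ∈ W) (x v w : E) :
    fderiv ℝ G y x v w = G y (christoffel G y x v) w + G y v (christoffel G y x w) := by
  have h1 := hG.two_mul_christoffel hy x v w
  have h2 := hG.two_mul_christoffel hy x w v
  rw [hG.symm y hy v]
  rw [hG.fderiv_symm hy x w v] at h2
  linarith

/-- The Levi-Civita connection is the only symmetric metric connection. -/
theorem christoffel_unique (hG : IsMetricOn G W) {y : E} (hy : y ∈ W) {S : E → E → E}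
    (hS : ∀ u v, S u v = S v u)
    (h : ∀ x v w, fderiv ℝ G y x v w = G y (S x v) w + G y v (S x w)) (u v : E) :
    christoffel G y u v = S u v := by
  refine hG.eq_of_forall hy fun w => ?_
  have h1 := hG.two_mul_christoffel hy u v w
  rw [h, h, h, hS v u, hS w u, hS w v, hG.symm y hy u (S v w), hG.symm y hy v] at h1
  linarith

theorem contDiffOn_christoffel (hG : IsMetricOn G W) : ContDiffOn ℝ ∞ (christoffel G) W := by
  refine contDiffOn_clm_apply.2 fun u => contDiffOn_clm_apply.2 fun v => ?_
  have hk : ContDiffOn ℝ ∞ (fun y => koszul G y u v) W := by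
    refine contDiffOn_clm_apply.2 fun w => ?_
    simp only [koszul_apply]
    have h := hG.contDiffOn_fderiv
    have hc (a b c : E) : ContDiffOn ℝ ∞ (fun y => fderiv ℝ G y a b c) W :=
      ((h.clm_apply contDiffOn_const).clm_apply contDiffOn_const).clm_apply contDiffOn_const
    exact ((hc _ _ _).add (hc _ _ _)).sub (hc _ _ _)
  exact hG.contDiffOn_inverse.clm_apply (hk.const_smul (1 / 2 : ℝ))

theorem differentiableAt_christoffel (hG : IsMetricOn G W) {y : E} (hy : y ∈ W) :
    DifferentiableAt ℝ (christoffel G) y :=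
  (hG.contDiffOn_christoffel.contDiffAt (hG.isOpen.mem_nhds hy)).differentiableAt (by simp)

theorem fderiv_christoffel_symm (hG : IsMetricOn G W) {y : E} (hy : y ∈ W) (x v w : E) :
    fderiv ℝ (christoffel G) y x v w = fderiv ℝ (christoffel G) y x w v := by
  rw [← fderiv_clm_apply₂ (hG.differentiableAt_christoffel hy),
    ← fderiv_clm_apply₂ (hG.differentiableAt_christoffel hy)]
  congr 1
  apply Filter.EventuallyEq.fderiv_eq
  filter_upwards [hG.isOpen.mem_nhds hy] with z hz using hG.christoffel_symm hz v w

end IsMetricOn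

theorem curvature_apply (G : E → E →L[ℝ] E →L[ℝ] ℝ) (y u v w : E) :
    curvature G y v w u = fderiv ℝ (christoffel G) y u v w - fderiv ℝ (christoffel G) y v u w
      + christoffel G y u (christoffel G y v w) - christoffel G y v (christoffel G y u w) := rfl

theorem curvature_swap (G : E → E →L[ℝ] E →L[ℝ] ℝ) (y u v w : E) :
    curvature G y v w u = -curvature G y u w v := by
  simp only [curvature_apply]; abel

namespace IsMetricOn

variable {G : E → E →L[ℝ] E →L[ℝ] ℝ} {W : Set E} [FiniteDimensional ℝ E]

theorem curvature_skew (hG : IsMetricOn G W) {y : E} (hy : y ∈ W) (a b v w : E) :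
    G y (curvature G y b v a) w = -G y v (curvature G y b w a) := by
  have key (a b : E) : fderiv ℝ (fderiv ℝ G) y a b v w =
      G y (christoffel G y a (christoffel G y b v)) w
        + G y (christoffel G y b v) (christoffel G y a w)
        + G y (fderiv ℝ (christoffel G) y a b v) w
        + (G y (christoffel G y a v) (christoffel G y b w)
        + G y v (christoffel G y a (christoffel G y b w))
        + G y v (fderiv ℝ (christoffel G) y a b w)) := by
    have hd : DifferentiableAt ℝ (fderiv ℝ G) y :=
      (hG.contDiffOn_fderiv.contDiffAt (hG.isOpen.mem_nhds hy)).differentiableAt (by simp)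
    have hΓ := hG.differentiableAt_christoffel hy
    have hΓ' (b v : E) : DifferentiableAt ℝ (fun z => christoffel G z b v) y :=
      (hΓ.clm_apply (differentiableAt_const _)).clm_apply (differentiableAt_const _)
    have hg := hG.differentiableAt hy
    rw [← fderiv_clm_apply₁ hd, ← fderiv_clm_apply₂ (hd.clm_apply (differentiableAt_const _))]
    have he : (fun z => fderiv ℝ G z b v w) =ᶠ[nhds y] fun z =>
        G z (christoffel G z b v) w + G z v (christoffel G z b w) := by
      filter_upwards [hG.isOpen.mem_nhds hy] with z hz using hG.fderiv_eq hz b v w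
    rw [he.fderiv_eq, fderiv_fun_add]
    · rw [add_apply, fderiv_bilin_apply hg (hΓ' b v) (differentiableAt_const w),
        fderiv_bilin_apply hg (differentiableAt_const v) (hΓ' b w), fderiv_clm_apply₂ hΓ,
        fderiv_clm_apply₂ hΓ, hG.fderiv_eq hy, hG.fderiv_eq hy]
      simp
    · exact (hg.clm_apply (hΓ' b v)).clm_apply (differentiableAt_const w)
    · exact (hg.clm_apply (differentiableAt_const v)).clm_apply (hΓ' b w)
  have h1 := key a b
  have h2 := key b a
  rw [hG.fderiv_fderiv_symm hy a b] at h1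
  rw [h1] at h2
  simp only [curvature_apply, map_add, map_sub, add_apply,
    sub_apply]
  linarith

theorem curvature_bianchi (hG : IsMetricOn G W) {y : E} (hy : y ∈ W) (u v w : E) :
    curvature G y v w u + curvature G y w u v + curvature G y u v w = 0 := by
  simp only [curvature_apply]
  rw [hG.christoffel_symm hy w u, hG.christoffel_symm hy v u, hG.christoffel_symm hy w v,
    hG.fderiv_christoffel_symm hy w u v, hG.fderiv_christoffel_symm hy u w v,
    hG.fderiv_christoffel_symm hy v w u]
  abel

/-- Pair symmetry of the curvature tensor, `⟨R(a, b) v, w⟩ = ⟨R(v, w) a, b⟩`. -/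
theorem curvature_pair_symm (hG : IsMetricOn G W) {y : E} (hy : y ∈ W) (a b v w : E) :
    G y (curvature G y b v a) w = G y (curvature G y w a v) b := by
  have bi (a b c d : E) : G y (curvature G y b c a) d + G y (curvature G y c a b) d
      + G y (curvature G y a b c) d = 0 := by
    have := congrArg (fun z => G y z d) (hG.curvature_bianchi hy a b c)
    simpa using this
  have sk (a b v w : E) : G y (curvature G y b v a) w = -G y (curvature G y b w a) v := by
    rw [hG.curvature_skew hy, hG.symm y hy]
  have sw (a b v w : E) : G y (curvature G y b v a) w = -G y (curvature G y a v b) w := by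
    rw [curvature_swap]; simp
  have h1 := bi a b v w
  have h2 := bi b v w a
  have h3 := bi v w a b
  have h4 := bi w a b v
  have e1 := sk a b w v
  have e2 := sk b v a w
  have e3 := sk v a b w
  have e4 := sk v w b a
  have e5 := sk w b v a
  have e6 := sk w a b v
  have e7 := sk a v w b
  have e8 := sk a b v w
  have e9 := sw a v w b
  have e10 := sw v a w b
  have e11 := sw w b v a
  have e12 := sw w b a v
  have e13 := sw b w a v
  have e14 := sw v w a b
  have e15 := sk v w a b
  have e16 := sk b w a v
  have e17 := sw w a v b
  have e18 := sk w a v b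
  linarith

end IsMetricOn
end LocalGeometry

/-! ### Covariant derivatives, divergences and the Ricci identity -/

section CovariantDerivative

variable {E : Type*} [NormedAddCommGroup E] [NormedSpace ℝ E]

/-- The covariant derivative `v ↦ ∇_v Z` at `y` of the vector field `Z` with respect to the
Levi-Civita connection of the metric `G` on an open subset of `E`. -/
def covDeriv (G : E → E →L[ℝ] E →L[ℝ] ℝ) (Z : E → E) (y : E) : E →L[ℝ] E :=
  fderiv ℝ Z y + (christoffel G y).flip (Z y)

theorem covDeriv_apply (G : E → E →L[ℝ] E →L[ℝ] ℝ) (Z : E → E) (y v : E) :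
    covDeriv G Z y v = fderiv ℝ Z y v + christoffel G y v (Z y) := rfl

/-- The divergence of the vector field `Z` with respect to the metric `G`. -/
def divergence (G : E → E →L[ℝ] E →L[ℝ] ℝ) (Z : E → E) (y : E) : ℝ :=
  LinearMap.trace ℝ E (covDeriv G Z y)

variable [FiniteDimensional ℝ E]

theorem fderiv_trace {B : E → E →L[ℝ] E} {p : E} (hB : DifferentiableAt ℝ B p) (x : E) :
    fderiv ℝ (fun y => LinearMap.trace ℝ E (B y)) p x =
      LinearMap.trace ℝ E (fderiv ℝ B p x : E →L[ℝ] E) := by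
  let T : (E →L[ℝ] E) →L[ℝ] ℝ :=
    LinearMap.toContinuousLinearMap (LinearMap.trace ℝ E ∘ₗ ContinuousLinearMap.coeLM ℝ)
  have : (fun y => LinearMap.trace ℝ E (B y)) = fun y => T (B y) := rfl
  rw [this]
  exact congrArg (fun L => L x) (T.hasFDerivAt.comp p hB.hasFDerivAt).fderiv

theorem contDiffOn_trace {B : E → E →L[ℝ] E} {W : Set E} {n : ℕ∞ω} (hB : ContDiffOn ℝ n B W) :
    ContDiffOn ℝ n (fun y => LinearMap.trace ℝ E (B y)) W := by
  let T : (E →L[ℝ] E) →L[ℝ] ℝ :=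
    LinearMap.toContinuousLinearMap (LinearMap.trace ℝ E ∘ₗ ContinuousLinearMap.coeLM ℝ)
  exact T.contDiff.comp_contDiffOn hB

/-- An endomorphism which is skew-symmetric for a nondegenerate bilinear form is trace-free. -/
theorem trace_eq_zero_of_skew {G : E →L[ℝ] E →L[ℝ] ℝ} (hG : G.IsInvertible)
    {T : E →ₗ[ℝ] E} (h : ∀ v w, G (T v) w = -G v (T w)) :
    LinearMap.trace ℝ E T = 0 := by
  obtain ⟨e, he⟩ := hG
  let Φ : E ≃ₗ[ℝ] Module.Dual ℝ E :=
    e.toLinearEquiv.trans (LinearMap.toContinuousLinearMap (𝕜 := ℝ) (E := E) (F' := ℝ)).symm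
  have hΦ (v w : E) : Φ v w = G v w := by rw [← he]; rfl
  have h1 : Φ.conj T = -Module.Dual.transpose (R := ℝ) T := by
    ext α w
    obtain ⟨v, rfl⟩ := Φ.surjective α
    simp [LinearEquiv.conj_apply, Module.Dual.transpose_apply, hΦ, h]
  have h2 := LinearMap.trace_conj' T Φ
  rw [h1, map_neg, LinearMap.trace_transpose'] at h2
  linarith

theorem IsMetricOn.contDiffOn_covDeriv {G : E → E →L[ℝ] E →L[ℝ] ℝ} {W : Set E}
    (hG : IsMetricOn G W) {Z : E → E} (hZ : ContDiffOn ℝ ∞ Z W) :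
    ContDiffOn ℝ ∞ (covDeriv G Z) W := by
  refine contDiffOn_clm_apply.2 fun v => ?_
  simp only [covDeriv_apply]
  exact ((hZ.fderiv_of_isOpen hG.isOpen (by simp)).clm_apply contDiffOn_const).add
    ((hG.contDiffOn_christoffel.clm_apply contDiffOn_const).clm_apply hZ)

theorem fderiv_covDeriv {G : E → E →L[ℝ] E →L[ℝ] ℝ} {W : Set E} (hG : IsMetricOn G W)
    {Z : E → E} (hZ : ContDiffOn ℝ ∞ Z W) {p : E} (hp : p ∈ W) (x z : E) :
    fderiv ℝ (covDeriv G Z) p x z = fderiv ℝ (fderiv ℝ Z) p x z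
      + fderiv ℝ (christoffel G) p x z (Z p) + christoffel G p z (fderiv ℝ Z p x) := by
  have hW := hG.isOpen.mem_nhds hp
  have hB : DifferentiableAt ℝ (covDeriv G Z) p :=
    ((hG.contDiffOn_covDeriv hZ).contDiffAt hW).differentiableAt (by simp)
  have hZ1 : DifferentiableAt ℝ Z p := (hZ.contDiffAt hW).differentiableAt (by simp)
  have hZ2 : DifferentiableAt ℝ (fderiv ℝ Z) p :=
    ((hZ.fderiv_of_isOpen hG.isOpen (m := ∞) (by simp)).contDiffAt hW).differentiableAt (by simp)
  have hΓ := hG.differentiableAt_christoffel hp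
  rw [← fderiv_clm_apply₁ hB]
  simp only [covDeriv_apply]
  rw [fderiv_fun_add (hZ2.clm_apply (differentiableAt_const z))
    ((hΓ.clm_apply (differentiableAt_const z)).clm_apply hZ1), add_apply,
    fderiv_clm_apply₁ hZ2, fderiv_bilin_apply hΓ (differentiableAt_const z) hZ1]
  simp [add_assoc]

/-- The Ricci identity `(∇_x ∇Z)(z) - (∇_z ∇Z)(x) = R(x, z) Z`. -/
theorem ricci_identity {G : E → E →L[ℝ] E →L[ℝ] ℝ} {W : Set E} (hG : IsMetricOn G W)
    {Z : E → E} (hZ : ContDiffOn ℝ ∞ Z W) {p : E} (hp : p ∈ W) (x z : E) :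
    fderiv ℝ (covDeriv G Z) p x z + christoffel G p x (covDeriv G Z p z) =
      fderiv ℝ (covDeriv G Z) p z x + christoffel G p z (covDeriv G Z p x)
        + curvature G p z (Z p) x := by
  have hs : IsSymmSndFDerivAt ℝ Z p :=
    isSymmSndFDerivAt (hZ.contDiffAt (hG.isOpen.mem_nhds hp))
  rw [fderiv_covDeriv hG hZ hp, fderiv_covDeriv hG hZ hp, hs.eq x z]
  simp only [covDeriv_apply, curvature_apply, map_add]
  abel

end CovariantDerivative

/-! ### Kähler metrics -/

section KahlerGeometry

variable {E : Type*} [NormedAddCommGroup E] [NormedSpace ℂ E]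

variable (E) in
/-- Multiplication by `i`, as a real linear map. -/
def mulI : E →ₗ[ℝ] E where
  toFun v := Complex.I • v
  map_add' := smul_add _
  map_smul' c v := smul_comm _ c v

theorem mulI_apply (v : E) : mulI E v = Complex.I • v := rfl

theorem I_smul_I_smul (v : E) : Complex.I • Complex.I • v = -v := by
  rw [smul_smul, Complex.I_mul_I, neg_one_smul]

/-- `K` is a Kähler metric on the open subset `W` of the complex vector space `E`: it is Hermitian
and its fundamental form `K(i·, ·)` is closed. -/
structure IsKahlerMetricOn (K : E → E →L[ℝ] E →L[ℝ] ℝ) (W : Set E) : Prop extends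
    IsMetricOn K W where
  hermitian : ∀ y ∈ W, ∀ v w, K y (Complex.I • v) (Complex.I • w) = K y v w
  closed : ∀ y ∈ W, ∀ u v w, fderiv ℝ K y u (Complex.I • v) w + fderiv ℝ K y v (Complex.I • w) u
    + fderiv ℝ K y w (Complex.I • u) v = 0

theorem hermitian_left {K : E →L[ℝ] E →L[ℝ] ℝ}
    (h : ∀ v w, K (Complex.I • v) (Complex.I • w) = K v w) (v w : E) :
    K (Complex.I • v) w = -K v (Complex.I • w) := by
  rw [← h v, I_smul_I_smul, map_neg, neg_neg]

namespace IsKahlerMetricOn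

variable {K : E → E →L[ℝ] E →L[ℝ] ℝ} {W : Set E}

theorem fderiv_hermitian (hK : IsKahlerMetricOn K W) {y : E} (hy : y ∈ W) (x v w : E) :
    fderiv ℝ K y x (Complex.I • v) (Complex.I • w) = fderiv ℝ K y x v w := by
  rw [← fderiv_clm_apply₂ (hK.differentiableAt hy), ← fderiv_clm_apply₂ (hK.differentiableAt hy)]
  congr 1
  apply Filter.EventuallyEq.fderiv_eq
  filter_upwards [hK.isOpen.mem_nhds hy] with z hz using hK.hermitian z hz v w

variable [FiniteDimensional ℝ E]

/-- The complex structure is parallel for the Levi-Civita connection of a Kähler metric. -/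
theorem christoffel_I_smul (hK : IsKahlerMetricOn K W) {y : E} (hy : y ∈ W) (u v : E) :
    christoffel K y u (Complex.I • v) = Complex.I • christoffel K y u v := by
  refine hK.eq_of_forall hy fun w => ?_
  rw [hermitian_left (hK.hermitian y hy)]
  have h1 := hK.two_mul_christoffel hy u (Complex.I • v) w
  have h2 := hK.two_mul_christoffel hy u v (Complex.I • w)
  have h3 := hK.closed y hy u v w
  have h4 := hK.closed y hy u (Complex.I • v) (Complex.I • w)
  have hl (x v w : E) := hermitian_left (hK.fderiv_hermitian hy x) v w
  have hs (x v w : E) := hK.fderiv_symm hy x v w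
  simp only [I_smul_I_smul, hK.fderiv_hermitian hy, map_neg, neg_apply] at h4
  have e1 := hl u v w
  have e2 := hs w u (Complex.I • v)
  have e3 := hl w v u
  have e4 := hs v u (Complex.I • w)
  have e5 := hs (Complex.I • v) w u
  have e6 := hl w u v
  linarith

theorem fderiv_christoffel_I_smul (hK : IsKahlerMetricOn K W) {y : E} (hy : y ∈ W) (x u v : E) :
    fderiv ℝ (christoffel K) y x u (Complex.I • v) =
      Complex.I • fderiv ℝ (christoffel K) y x u v := by
  have hΓ := hK.differentiableAt_christoffel hy
  rw [← fderiv_clm_apply₂ hΓ, ← fderiv_clm_apply₂ hΓ]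
  have he : (fun z => christoffel K z u (Complex.I • v)) =ᶠ[nhds y]
      fun z => Complex.I • christoffel K z u v := by
    filter_upwards [hK.isOpen.mem_nhds hy] with z hz using hK.christoffel_I_smul hz u v
  rw [he.fderiv_eq, fderiv_fun_const_smul]
  · rfl
  · exact (hΓ.clm_apply (differentiableAt_const _)).clm_apply (differentiableAt_const _)

theorem curvature_I_smul (hK : IsKahlerMetricOn K W) {y : E} (hy : y ∈ W) (u v w : E) :
    curvature K y v (Complex.I • w) u = Complex.I • curvature K y v w u := by
  simp only [curvature_apply, hK.christoffel_I_smul hy, hK.fderiv_christoffel_I_smul hy, smul_add,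
    smul_sub]

theorem curvature_I_smul_I_smul (hK : IsKahlerMetricOn K W) {y : E} (hy : y ∈ W) (u v w : E) :
    curvature K y (Complex.I • v) w (Complex.I • u) = curvature K y v w u := by
  refine hK.eq_of_forall hy fun z => ?_
  rw [hK.curvature_pair_symm hy, hK.curvature_I_smul hy, hK.hermitian y hy,
    ← hK.curvature_pair_symm hy]

/-- The Ricci tensor of a Kähler metric is invariant under the complex structure. -/
theorem ricci_I_smul_I_smul (hK : IsKahlerMetricOn K W) {y : E} (hy : y ∈ W) (v w : E) :
    ricci K y (Complex.I • v) (Complex.I • w) = ricci K y v w := by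
  change LinearMap.trace ℝ E (curvature K y (Complex.I • v) (Complex.I • w)) =
    LinearMap.trace ℝ E (curvature K y v w)
  have h1 : curvature K y (Complex.I • v) (Complex.I • w) =
      mulI E ∘ₗ curvature K y (Complex.I • v) w := by
    ext u; simp [mulI_apply, hK.curvature_I_smul hy]
  have h2 : curvature K y (Complex.I • v) w ∘ₗ mulI E = curvature K y v w := by
    ext u; simp [mulI_apply, hK.curvature_I_smul_I_smul hy]
  rw [h1, LinearMap.trace_comp_comm', h2]

/-- On a Kähler manifold, a vector field `Z` whose covariant derivative commutes with the complex
structure and is symmetric satisfies `d (div Z) = -2 Ric(·, Z)`. This comes from comparing the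
traces of the Ricci identity for `z` and `i z`. -/
theorem fderiv_divergence (hK : IsKahlerMetricOn K W) {Z : E → E} (hZ : ContDiffOn ℝ ∞ Z W)
    (hI : ∀ y ∈ W, ∀ v, covDeriv K Z y (Complex.I • v) = Complex.I • covDeriv K Z y v)
    (hs : ∀ y ∈ W, ∀ v w, K y (covDeriv K Z y v) w = K y v (covDeriv K Z y w))
    {p : E} (hp : p ∈ W) (z : E) :
    fderiv ℝ (divergence K Z) p z = -2 * ricci K p z (Z p) := by
  set B := covDeriv K Z with hBdef
  have hW := hK.isOpen.mem_nhds hp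
  have hB : DifferentiableAt ℝ B p :=
    ((hK.contDiffOn_covDeriv hZ).contDiffAt hW).differentiableAt (by simp)
  have hBI (x z : E) : fderiv ℝ B p x (Complex.I • z) = Complex.I • fderiv ℝ B p x z := by
    rw [← fderiv_clm_apply₁ hB, ← fderiv_clm_apply₁ hB]
    have he : (fun y => B y (Complex.I • z)) =ᶠ[nhds p] fun y => Complex.I • B y z := by
      filter_upwards [hW] with y hy using hI y hy z
    rw [he.fderiv_eq, fderiv_fun_const_smul (hB.clm_apply (differentiableAt_const _))]
    rfl
  -- the covariant derivative of the endomorphism field `B` in the direction `z`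
  let N : E → E →ₗ[ℝ] E := fun z => (fderiv ℝ B p z : E →L[ℝ] E).toLinearMap
    + ((christoffel K p z : E →L[ℝ] E).toLinearMap ∘ₗ (B p).toLinearMap
      - (B p).toLinearMap ∘ₗ (christoffel K p z : E →L[ℝ] E).toLinearMap)
  have hN (z : E) : LinearMap.trace ℝ E (N z) = fderiv ℝ (divergence K Z) p z := by
    have : fderiv ℝ (divergence K Z) p z = LinearMap.trace ℝ E (fderiv ℝ B p z : E →L[ℝ] E) :=
      fderiv_trace hB z
    rw [this, map_add, map_sub, LinearMap.trace_comp_comm', sub_self, add_zero]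
  have hIN (z : E) : LinearMap.trace ℝ E (mulI E ∘ₗ N z) = 0 := by
    have h0 : ∀ y ∈ W, LinearMap.trace ℝ E (mulI E ∘ₗ (B y).toLinearMap) = 0 := by
      intro y hy
      refine trace_eq_zero_of_skew (hK.isInvertible hy) fun v w => ?_
      simp only [LinearMap.comp_apply, mulI_apply, ContinuousLinearMap.coe_coe]
      rw [hermitian_left (hK.hermitian y hy), hs y hy, hI y hy]
    let IB : E → E →L[ℝ] E := fun y => (mulI E).toContinuousLinearMap ∘L B y
    have hIB : HasFDerivAt IB ((ContinuousLinearMap.compL ℝ E E E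
        (mulI E).toContinuousLinearMap) ∘L fderiv ℝ B p) p :=
      (ContinuousLinearMap.compL ℝ E E E (mulI E).toContinuousLinearMap).hasFDerivAt.comp p
        hB.hasFDerivAt
    have h1 : LinearMap.trace ℝ E (mulI E ∘ₗ (fderiv ℝ B p z : E →L[ℝ] E).toLinearMap) = 0 := by
      have h2 := fderiv_trace hIB.differentiableAt z
      rw [hIB.fderiv] at h2
      have h3 : (fun y => LinearMap.trace ℝ E (IB y)) =ᶠ[nhds p] fun _ => (0 : ℝ) := by
        filter_upwards [hW] with y hy using h0 y hy
      rw [h3.fderiv_eq] at h2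
      simpa using h2.symm
    have h4 : mulI E ∘ₗ (B p).toLinearMap = (B p).toLinearMap ∘ₗ mulI E := by
      ext v; simp [mulI_apply, hI p hp]
    rw [LinearMap.comp_add, LinearMap.comp_sub, map_add, map_sub, h1, ← LinearMap.comp_assoc,
      LinearMap.trace_comp_comm', ← LinearMap.comp_assoc, ← LinearMap.comp_assoc, h4, sub_self,
      add_zero]
  have key (z : E) : N (Complex.I • z) + curvature K p (Complex.I • z) (Z p) =
      mulI E ∘ₗ N z + curvature K p z (Complex.I • Z p) := by
    ext x
    have r1 := ricci_identity hK.toIsMetricOn hZ hp x z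
    have r2 := ricci_identity hK.toIsMetricOn hZ hp x (Complex.I • z)
    rw [← hBdef] at r1 r2
    have r3 := congrArg (fun v => Complex.I • v) r1
    simp only [hBI, hI p hp, hK.christoffel_I_smul hp, smul_add] at r2 r3
    simp only [N, LinearMap.add_apply, LinearMap.sub_apply, LinearMap.comp_apply, mulI_apply,
      ContinuousLinearMap.coe_coe, hK.curvature_I_smul hp, smul_add, smul_sub]
    have r4 : B p (christoffel K p (Complex.I • z) x) = Complex.I • B p (christoffel K p z x) := by
      rw [hK.christoffel_symm hp, hK.christoffel_I_smul hp, hI p hp, hK.christoffel_symm hp]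
    rw [r4]
    linear_combination (norm := module) r2.symm.trans r3
  have tr (z : E) := congrArg (LinearMap.trace ℝ E) (key z)
  simp only [map_add, hN, hIN] at tr
  have e := tr (-(Complex.I • z))
  have hz : Complex.I • -(Complex.I • z) = z := by rw [smul_neg, I_smul_I_smul, neg_neg]
  have e2 : ricci K p (-(Complex.I • z)) (Complex.I • Z p) = -ricci K p z (Z p) := by
    rw [map_neg, LinearMap.neg_apply, hK.ricci_I_smul_I_smul hp]
  rw [hz] at e
  change _ + ricci K p z (Z p) = 0 + ricci K p (-(Complex.I • z)) (Complex.I • Z p) at e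
  rw [e2] at e
  linarith

end IsKahlerMetricOn
end KahlerGeometry

/-! ### Conformal changes of metric -/

section ConformalChange

variable {E : Type*} [NormedAddCommGroup E] [NormedSpace ℝ E]

/-- The vector field dual to the 1-form `α` with respect to the metric `G`. -/
def sharp (G : E → E →L[ℝ] E →L[ℝ] ℝ) (α : E → E →L[ℝ] ℝ) (y : E) : E := (G y).inverse (α y)

/-- The metric `e^{-2f} G`. -/
def conformal (G : E → E →L[ℝ] E →L[ℝ] ℝ) (f : E → ℝ) (y : E) : E →L[ℝ] E →L[ℝ] ℝ :=
  Real.exp (-2 * f y) • G y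

theorem conformal_apply (G : E → E →L[ℝ] E →L[ℝ] ℝ) (f : E → ℝ) (y v w : E) :
    conformal G f y v w = Real.exp (-2 * f y) * G y v w := rfl

namespace IsMetricOn

variable {G : E → E →L[ℝ] E →L[ℝ] ℝ} {W : Set E} {f : E → ℝ}

theorem conformal (hG : IsMetricOn G W) (hf : ContDiffOn ℝ ∞ f W) :
    IsMetricOn (conformal G f) W where
  isOpen := hG.isOpen
  contDiffOn := (contDiffOn_const.mul hf).exp.smul hG.contDiffOn
  symm y hy v w := by rw [conformal_apply, conformal_apply, hG.symm y hy]
  pos y hy v hv := mul_pos (Real.exp_pos _) (hG.pos y hy v hv)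

theorem fderiv_conformal (hG : IsMetricOn G W) (hf : ContDiffOn ℝ ∞ f W) {y : E} (hy : y ∈ W)
    (x v w : E) : fderiv ℝ (LcK.conformal G f) y x v w =
      Real.exp (-2 * f y) * (fderiv ℝ G y x v w - 2 * fderiv ℝ f y x * G y v w) := by
  have hf' : DifferentiableAt ℝ f y :=
    (hf.contDiffAt (hG.isOpen.mem_nhds hy)).differentiableAt (by simp)
  have h := ((hf'.hasFDerivAt.const_mul (-2)).exp).smul (hG.differentiableAt hy).hasFDerivAt
  have h' : HasFDerivAt (LcK.conformal G f) _ y := h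
  rw [h'.fderiv]
  simp
  ring

theorem contDiffAt_fderiv (hG : IsMetricOn G W) (hf : ContDiffOn ℝ ∞ f W) {y : E} (hy : y ∈ W) :
     ContDiffAt ℝ ∞ (fderiv ℝ f) y :=
  (hf.fderiv_of_isOpen hG.isOpen (m := ∞) (by simp)).contDiffAt (hG.isOpen.mem_nhds hy)

theorem fderiv_fderiv_apply_symm (hG : IsMetricOn G W) (hf : ContDiffOn ℝ ∞ f W) {y : E} (hy : y ∈ W)
    (x z : E) :
    fderiv ℝ (fderiv ℝ f) y x z = fderiv ℝ (fderiv ℝ f) y z x := by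
  have hs : IsSymmSndFDerivAt ℝ f y :=
    isSymmSndFDerivAt (hf.contDiffAt (hG.isOpen.mem_nhds hy))
  exact hs.eq x z

variable [FiniteDimensional ℝ E]

theorem apply_sharp (hG : IsMetricOn G W) {α : E → E →L[ℝ] ℝ} {y : E} (hy : y ∈ W) (v : E) :
    G y (sharp G α y) v = α y v := by
  rw [sharp, hG.apply_inverse hy]

theorem contDiffOn_sharp (hG : IsMetricOn G W) {α : E → E →L[ℝ] ℝ} (hα : ContDiffOn ℝ ∞ α W) :
    ContDiffOn ℝ ∞ (sharp G α) W :=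
  hG.contDiffOn_inverse.clm_apply hα

/-- The Levi-Civita connection of `e^{-2f} G` is a Weyl connection for `G`, with Lee form `df`. -/
theorem fderiv_eq_weyl (hG : IsMetricOn G W) (hf : ContDiffOn ℝ ∞ f W) {y : E} (hy : y ∈ W)
    (x v w : E) : fderiv ℝ G y x v w = G y (christoffel (LcK.conformal G f) y x v) w
      + G y v (christoffel (LcK.conformal G f) y x w) + 2 * fderiv ℝ f y x * G y v w := by
  have h1 := hG.fderiv_conformal hf hy x v w
  rw [(hG.conformal hf).fderiv_eq hy, conformal_apply, conformal_apply, ← mul_add] at h1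
  have := mul_left_cancel₀ (Real.exp_pos _).ne' h1
  linarith

theorem christoffel_conformal (hG : IsMetricOn G W) (hf : ContDiffOn ℝ ∞ f W) {y : E} (hy : y ∈ W)
    (u v : E) : christoffel G y u v = christoffel (LcK.conformal G f) y u v
      + (fderiv ℝ f y u • v + fderiv ℝ f y v • u - G y u v • sharp G (fderiv ℝ f) y) := by
  refine hG.christoffel_unique hy (S := fun u v => christoffel (LcK.conformal G f) y u v
    + (fderiv ℝ f y u • v + fderiv ℝ f y v • u - G y u v • sharp G (fderiv ℝ f) y))
    (fun u v => ?_) (fun x v w => ?_) u v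
  · rw [(hG.conformal hf).christoffel_symm hy u v, hG.symm y hy u v]
    abel
  · have hX := hG.apply_sharp (α := fderiv ℝ f) hy
    have hX' (v : E) := (hG.symm y hy v _).trans (hX v)
    rw [hG.fderiv_eq_weyl hf hy]
    simp only [map_add, map_sub, map_smul, add_apply, sub_apply, smul_apply, hX, hX', smul_eq_mul]
    rw [hG.symm y hy v x]
    ring

section

variable (hG : IsMetricOn G W) (hf : ContDiffOn ℝ ∞ f W) {y : E} (hy : y ∈ W)
include hG hf hy

theorem differentiableAt_sharp : DifferentiableAt ℝ (sharp G (fderiv ℝ f)) y :=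
  ((hG.contDiffOn_sharp (hf.fderiv_of_isOpen hG.isOpen (m := ∞) (by simp))).contDiffAt
    (hG.isOpen.mem_nhds hy)).differentiableAt (by simp)

/-- The covariant derivative of `df` in terms of that of its dual vector field. -/
theorem fderiv_fderiv_eq (x z : E) : fderiv ℝ (fderiv ℝ f) y x z =
    fderiv ℝ f y (christoffel (LcK.conformal G f) y x z) + 2 * fderiv ℝ f y x * fderiv ℝ f y z
      + G y (covDeriv (LcK.conformal G f) (sharp G (fderiv ℝ f)) y x) z := by
  have hΘ : DifferentiableAt ℝ (fderiv ℝ f) y :=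
    (hG.contDiffAt_fderiv hf hy).differentiableAt (by simp)
  have hX := hG.differentiableAt_sharp hf hy
  have he : (fun y => fderiv ℝ f y z) =ᶠ[nhds y] fun y => G y (sharp G (fderiv ℝ f) y) z := by
    filter_upwards [hG.isOpen.mem_nhds hy] with y hy using (hG.apply_sharp hy z).symm
  rw [← fderiv_clm_apply₁ hΘ, he.fderiv_eq,
    fderiv_bilin_apply (hG.differentiableAt hy) hX (differentiableAt_const z),
    hG.fderiv_eq_weyl hf hy, covDeriv_apply, hG.apply_sharp hy, hG.apply_sharp hy]
  simp
  ring

theorem covDeriv_symm (x z : E) :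
    G y (covDeriv (LcK.conformal G f) (sharp G (fderiv ℝ f)) y x) z =
      G y (covDeriv (LcK.conformal G f) (sharp G (fderiv ℝ f)) y z) x := by
  have h1 := hG.fderiv_fderiv_eq hf hy x z
  have h2 := hG.fderiv_fderiv_eq hf hy z x
  rw [hG.fderiv_fderiv_apply_symm hf hy, h2, (hG.conformal hf).christoffel_symm hy] at h1
  linarith

theorem fderiv_christoffel_conformal (x v w : E) :
    fderiv ℝ (christoffel G) y x v w = fderiv ℝ (christoffel (LcK.conformal G f)) y x v w
      + (fderiv ℝ (fderiv ℝ f) y x v • w + fderiv ℝ (fderiv ℝ f) y x w • v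
        - fderiv ℝ G y x v w • sharp G (fderiv ℝ f) y
        - G y v w • fderiv ℝ (sharp G (fderiv ℝ f)) y x) := by
  have hΘ : DifferentiableAt ℝ (fderiv ℝ f) y :=
    (hG.contDiffAt_fderiv hf hy).differentiableAt (by simp)
  have hΘ' (v : E) : DifferentiableAt ℝ (fun z => fderiv ℝ f z v) y :=
    hΘ.clm_apply (differentiableAt_const v)
  have hX := hG.differentiableAt_sharp hf hy
  have hΓ := (hG.conformal hf).differentiableAt_christoffel hy
  have hΓ' : DifferentiableAt ℝ (fun z => christoffel (LcK.conformal G f) z v w) y :=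
    (hΓ.clm_apply (differentiableAt_const _)).clm_apply (differentiableAt_const _)
  have hG' : DifferentiableAt ℝ (fun z => G z v w) y :=
    ((hG.differentiableAt hy).clm_apply (differentiableAt_const _)).clm_apply
      (differentiableAt_const _)
  have he : (fun y => christoffel G y v w) =ᶠ[nhds y] fun y =>
      christoffel (LcK.conformal G f) y v w
      + (fderiv ℝ f y v • w + fderiv ℝ f y w • v - G y v w • sharp G (fderiv ℝ f) y) := by
    filter_upwards [hG.isOpen.mem_nhds hy] with y hy using hG.christoffel_conformal hf hy v w
  have hd := hΓ'.hasFDerivAt.fun_add ((((hΘ' v).hasFDerivAt.smul_const w).fun_add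
    ((hΘ' w).hasFDerivAt.smul_const v)).fun_sub (hG'.hasFDerivAt.fun_smul hX.hasFDerivAt))
  rw [← fderiv_clm_apply₂ (hG.differentiableAt_christoffel hy), he.fderiv_eq, hd.fderiv]
  simp only [add_apply, sub_apply, smul_apply, ContinuousLinearMap.smulRight_apply,
    fderiv_clm_apply₂ hΓ, fderiv_clm_apply₁ hΘ, fderiv_clm_apply₂ (hG.differentiableAt hy)]
  abel

theorem curvature_conformal (u v w : E) :
    let K := LcK.conformal G f
    let Θ := fderiv ℝ f y
    let X := sharp G (fderiv ℝ f) y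
    let A := covDeriv K (sharp G (fderiv ℝ f)) y
    curvature G y v w u = curvature K y v w u
      + ((G y (A w) u + Θ w * Θ u + Θ X * G y w u) • v
        - (G y (A v) w + Θ v * Θ w + Θ X * G y v w) • u
        + (Θ v * G y w u - G y v w * Θ u) • X - G y v w • A u + G y w u • A v) := by
  intro K Θ X A
  have hs := hG.symm y hy
  have hX (v : E) : G y X v = Θ v := hG.apply_sharp hy v
  have hX' (v : E) : G y v X = Θ v := (hs v _).trans (hX v)
  have hΓ (u v : E) : christoffel G y u v = christoffel K y u v + (Θ u • v + Θ v • u - G y u v • X) :=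
    hG.christoffel_conformal hf hy u v
  have hA (u : E) : fderiv ℝ (sharp G (fderiv ℝ f)) y u = A u - christoffel K y u X := by
    simp [A, covDeriv_apply, X]
  have hT (x z : E) : fderiv ℝ (fderiv ℝ f) y x z = Θ (christoffel K y x z) + 2 * Θ x * Θ z
      + G y (A x) z := hG.fderiv_fderiv_eq hf hy x z
  have hdG (x v w : E) : fderiv ℝ G y x v w = G y (christoffel K y x v) w
      + G y v (christoffel K y x w) + 2 * Θ x * G y v w := hG.fderiv_eq_weyl hf hy x v w
  have hAs (x z : E) : G y (A x) z = G y (A z) x := hG.covDeriv_symm hf hy x z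
  have hΓs (u v : E) : christoffel K y u v = christoffel K y v u :=
    (hG.conformal hf).christoffel_symm hy u v
  rw [curvature_apply, curvature_apply, hG.fderiv_christoffel_conformal hf hy,
    hG.fderiv_christoffel_conformal hf hy]
  simp only [hΓ, map_add, map_sub, map_smul, hX', hA, hT, hdG, smul_eq_mul]
  change fderiv ℝ (christoffel K) y u v w + _ - (fderiv ℝ (christoffel K) y v u w + _) + _ - _ = _
  rw [hAs u w, hAs u v, hΓs v u, hs u v, hs u w, hs u (christoffel K y v w)]
  module

/-- The Ricci tensor under a conformal change of the metric. -/
theorem ricci_conformal (v w : E) :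
    let K := LcK.conformal G f
    let Θ := fderiv ℝ f y
    let X := sharp G (fderiv ℝ f) y
    let A := covDeriv K (sharp G (fderiv ℝ f)) y
    ricci G y v w = ricci K y v w - (Module.finrank ℝ E - 2) * (G y (A v) w + Θ v * Θ w)
      - (LinearMap.trace ℝ E A + Module.finrank ℝ E * Θ X) * G y v w := by
  intro K Θ X A
  have hAs (x z : E) : G y (A x) z = G y (A z) x := hG.covDeriv_symm hf hy x z
  have hX (v : E) : G y X v = Θ v := hG.apply_sharp hy v
  have h : curvature G y v w = curvature K y v w
      + ((G y (A w) + Θ w • Θ + Θ X • G y w).toLinearMap.smulRight v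
        - (G y (A v) w + Θ v * Θ w + Θ X * G y v w) • LinearMap.id
        + (Θ v • G y w - G y v w • Θ).toLinearMap.smulRight X
        - G y v w • A.toLinearMap + (G y w).toLinearMap.smulRight (A v)) := by
    ext u
    rw [hG.curvature_conformal hf hy u v w]
    rfl
  change LinearMap.trace ℝ E (curvature G y v w) = LinearMap.trace ℝ E (curvature K y v w) - _ - _
  rw [h]
  simp only [map_add, map_sub, map_smul, LinearMap.trace_smulRight, LinearMap.trace_id,
    ContinuousLinearMap.coe_coe, add_apply, sub_apply, smul_apply, smul_eq_mul]
  rw [hAs w v, hG.symm y hy w X, hX, hG.symm y hy w (A v), hG.symm y hy w v]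
  ring

theorem covDeriv_sharp (v : E) :
    covDeriv G (sharp G (fderiv ℝ f)) y v =
      covDeriv (LcK.conformal G f) (sharp G (fderiv ℝ f)) y v
        + fderiv ℝ f y (sharp G (fderiv ℝ f) y) • v := by
  rw [covDeriv_apply, covDeriv_apply, hG.christoffel_conformal hf hy, hG.symm y hy v,
    hG.apply_sharp hy]
  module

theorem divergence_sharp :
    divergence G (sharp G (fderiv ℝ f)) y =
      LinearMap.trace ℝ E (covDeriv (LcK.conformal G f) (sharp G (fderiv ℝ f)) y)
        + Module.finrank ℝ E * fderiv ℝ f y (sharp G (fderiv ℝ f) y) := by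
  have h : (covDeriv G (sharp G (fderiv ℝ f)) y).toLinearMap =
      (covDeriv (LcK.conformal G f) (sharp G (fderiv ℝ f)) y).toLinearMap
        + fderiv ℝ f y (sharp G (fderiv ℝ f) y) • LinearMap.id := by
    ext v
    exact hG.covDeriv_sharp hf hy v
  rw [divergence, h, map_add, map_smul, LinearMap.trace_id, smul_eq_mul,
    mul_comm (_ : ℝ) (Module.finrank ℝ E : ℝ)]

/-- The covariant derivative, for `e^{-2f} G`, of the gradient field `e^f X` (up to sign, the
gradient of `e^{-f}` with respect to `e^{-2f} G`). -/
theorem covDeriv_exp_smul_sharp (v : E) :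
    covDeriv (LcK.conformal G f) (fun z => Real.exp (f z) • sharp G (fderiv ℝ f) z) y v =
      Real.exp (f y) • (covDeriv (LcK.conformal G f) (sharp G (fderiv ℝ f)) y v
        + fderiv ℝ f y v • sharp G (fderiv ℝ f) y) := by
  have hf' : DifferentiableAt ℝ f y :=
    (hf.contDiffAt (hG.isOpen.mem_nhds hy)).differentiableAt (by simp)
  have h := hf'.hasFDerivAt.exp.fun_smul (hG.differentiableAt_sharp hf hy).hasFDerivAt
  rw [covDeriv_apply, covDeriv_apply, h.fderiv]
  simp only [add_apply, smul_apply, ContinuousLinearMap.smulRight_apply, map_smul, smul_eq_mul]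
  module

theorem fderiv_normSq (x : E) :
    fderiv ℝ (fun z => fderiv ℝ f z (sharp G (fderiv ℝ f) z)) y x =
      2 * (G y (covDeriv (LcK.conformal G f) (sharp G (fderiv ℝ f)) y x)
        (sharp G (fderiv ℝ f) y) + fderiv ℝ f y x * fderiv ℝ f y (sharp G (fderiv ℝ f) y)) := by
  have hX := hG.differentiableAt_sharp hf hy
  have he : (fun z => fderiv ℝ f z (sharp G (fderiv ℝ f) z)) =ᶠ[nhds y]
      fun z => G z (sharp G (fderiv ℝ f) z) (sharp G (fderiv ℝ f) z) := by
    filter_upwards [hG.isOpen.mem_nhds hy] with y hy using (hG.apply_sharp hy _).symm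
  rw [he.fderiv_eq, fderiv_bilin_apply (hG.differentiableAt hy) hX hX, hG.fderiv_eq_weyl hf hy,
    covDeriv_apply, hG.apply_sharp hy, hG.apply_sharp hy, hG.apply_sharp hy, map_add, add_apply,
    hG.symm y hy _ (sharp G (fderiv ℝ f) y), hG.symm y hy _ (sharp G (fderiv ℝ f) y),
    hG.apply_sharp hy, hG.apply_sharp hy]
  ring

end

end IsMetricOn
end ConformalChange

/-! ### Einstein metrics conformal to Kähler metrics -/

section Einstein

variable {E : Type*} [NormedAddCommGroup E] [NormedSpace ℂ E]

theorem IsKahlerMetricOn.hermitian_of_conformal {G : E → E →L[ℝ] E →L[ℝ] ℝ} {W : Set E}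
    {f : E → ℝ} (hK : IsKahlerMetricOn (conformal G f) W) {y : E} (hy : y ∈ W) (v w : E) :
    G y (Complex.I • v) (Complex.I • w) = G y v w := by
  have := hK.hermitian y hy v w
  rw [conformal_apply, conformal_apply] at this
  exact mul_left_cancel₀ (Real.exp_pos _).ne' this

variable [FiniteDimensional ℝ E]

/-- The fundamental differential equation: if the Einstein metric `G` is conformal to the Kähler
metric `e^{-2f} G` then, with `X` the gradient of `f`, the function `P = |df|² - div X` satisfies
`dP = -(3 P - 2 c + (N - 4) |df|²) df`. As the Ricci tensors of both metrics are `J`-invariant, the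
covariant derivative of `e^f X` for the Kähler metric is `J`-invariant, so that
`IsKahlerMetricOn.fderiv_divergence` applies. -/
theorem fderiv_normSq_sub_divergence {G : E → E →L[ℝ] E →L[ℝ] ℝ} {W : Set E} {f : E → ℝ} {c : ℝ}
    (hG : IsMetricOn G W) (hf : ContDiffOn ℝ ∞ f W) (hK : IsKahlerMetricOn (conformal G f) W)
    (hric : ∀ y ∈ W, ∀ v w, ricci G y v w = c * G y v w) (hN : 2 < Module.finrank ℝ E)
    {p : E} (hp : p ∈ W) (z : E) :
    let X := sharp G (fderiv ℝ f)
    let P := fun y => fderiv ℝ f y (X y) - divergence G X y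
    fderiv ℝ P p z = -(3 * P p - 2 * c + (Module.finrank ℝ E - 4) * fderiv ℝ f p (X p))
      * fderiv ℝ f p z := by
  intro X P
  have hN' : (0 : ℝ) < (Module.finrank ℝ E : ℝ) - 2 := by
    have : (2 : ℝ) < Module.finrank ℝ E := by exact_mod_cast hN
    linarith
  have hherm := fun y (hy : y ∈ W) => hK.hermitian_of_conformal hy
  let K := conformal G f
  let A := covDeriv K X
  let V : E → E := fun z => Real.exp (f z) • X z
  let h : E → E → E → ℝ := fun y v w => G y (A y v) w + fderiv ℝ f y v * fderiv ℝ f y w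
  have hΘ : ContDiffOn ℝ ∞ (fderiv ℝ f) W := hf.fderiv_of_isOpen hG.isOpen (by simp)
  have hX : ContDiffOn ℝ ∞ X W := hG.contDiffOn_sharp hΘ
  have hV : ContDiffOn ℝ ∞ V W := hf.exp.smul hX
  -- `h` is a combination of the `J`-invariant forms `Ric` and `G`
  have hRic : ∀ y ∈ W, ∀ v w, ricci K y v w =
      (Module.finrank ℝ E - 2) * h y v w + (divergence G X y + c) * G y v w := by
    intro y hy v w
    have h1 := hG.ricci_conformal hf hy v w
    have h2 := hG.divergence_sharp hf hy
    simp only at h1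
    rw [← h2, hric y hy] at h1
    simp only [h, A, K, X]
    linarith
  have hhI : ∀ y ∈ W, ∀ v w, h y (Complex.I • v) (Complex.I • w) = h y v w := by
    intro y hy v w
    have h1 := hK.ricci_I_smul_I_smul hy v w
    rw [hRic y hy, hRic y hy, hherm y hy] at h1
    exact mul_left_cancel₀ hN'.ne' (by linarith)
  have hB : ∀ y ∈ W, ∀ v, covDeriv K V y v = Real.exp (f y) • (A y v + fderiv ℝ f y v • X y) :=
    fun y hy v => hG.covDeriv_exp_smul_sharp hf hy v
  have hGB : ∀ y ∈ W, ∀ v w, G y (covDeriv K V y v) w = Real.exp (f y) * h y v w := by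
    intro y hy v w
    rw [hB y hy]
    simp only [map_smul, map_add, add_apply, smul_apply, smul_eq_mul, X, hG.apply_sharp hy, h]
  have hhs : ∀ y ∈ W, ∀ v w, h y v w = h y w v := by
    intro y hy v w
    have := hG.covDeriv_symm hf hy v w
    simp only [h, A, K, X, this]
    ring
  have hdiv := hK.fderiv_divergence hV (fun y hy v => hG.eq_of_forall hy fun w => by
      rw [hermitian_left (hherm y hy), hGB y hy, hGB y hy, ← hhI y hy (Complex.I • v),
        I_smul_I_smul]
      simp only [h, map_neg, neg_apply]; ring)
    (fun y hy v w => by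
      rw [conformal_apply, conformal_apply, hG.symm y hy v, hGB y hy, hGB y hy, hhs y hy]) hp z
  have hW := hG.isOpen.mem_nhds hp
  let F : E → ℝ := fun y => fderiv ℝ f y (X y)
  let D : E → ℝ := divergence G X
  have hF : DifferentiableAt ℝ F p := ((hΘ.clm_apply hX).contDiffAt hW).differentiableAt (by simp)
  have hD : DifferentiableAt ℝ D p :=
    ((contDiffOn_trace (hG.contDiffOn_covDeriv hX)).contDiffAt hW).differentiableAt (by simp)
  have hfp : DifferentiableAt ℝ f p := (hf.contDiffAt hW).differentiableAt (by simp)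
  have hdivV : divergence K V =ᶠ[nhds p]
      fun y => Real.exp (f y) * (D y - (Module.finrank ℝ E - 1) * F y) := by
    filter_upwards [hW] with y hy
    have h1 : (covDeriv K V y).toLinearMap = Real.exp (f y) • ((A y).toLinearMap
        + (fderiv ℝ f y).toLinearMap.smulRight (X y)) := by
      ext v; exact hB y hy v
    have h2 := hG.divergence_sharp hf hy
    rw [divergence, h1, map_smul, map_add, LinearMap.trace_smulRight, smul_eq_mul]
    simp only [D, X, F, h2, A, K, ContinuousLinearMap.coe_coe]
    ring
  have hd := (hfp.hasFDerivAt.exp).fun_mul (hD.hasFDerivAt.fun_sub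
    (hF.hasFDerivAt.const_mul ((Module.finrank ℝ E : ℝ) - 1)))
  rw [hdivV.fderiv_eq, hd.fderiv, hRic p hp] at hdiv
  have hdF : fderiv ℝ F p z = 2 * h p z (X p) := hG.fderiv_normSq hf hp z
  have hP : fderiv ℝ P p z = fderiv ℝ F p z - fderiv ℝ D p z := by
    change fderiv ℝ (fun y => F y - D y) p z = _
    rw [fderiv_fun_sub hF hD]; rfl
  have hhV : h p z (V p) = Real.exp (f p) * h p z (X p) := by
    simp only [h, V, map_smul, smul_eq_mul]; ring
  have hGV : G p z (V p) = Real.exp (f p) * fderiv ℝ f p z := by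
    rw [hG.symm p hp]
    simp only [V, map_smul, smul_apply, smul_eq_mul, X, hG.apply_sharp hp]
  rw [hhV, hGV] at hdiv
  simp only [add_apply, sub_apply, smul_apply, smul_eq_mul] at hdiv
  have hdiv' : fderiv ℝ D p z - (Module.finrank ℝ E - 1) * fderiv ℝ F p z
      + (D p - (Module.finrank ℝ E - 1) * F p) * fderiv ℝ f p z =
      -2 * ((Module.finrank ℝ E - 2) * h p z (X p) + (D p + c) * fderiv ℝ f p z) := by
    apply mul_left_cancel₀ (Real.exp_pos (f p)).ne'
    linear_combination hdiv
  rw [hP]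
  simp only [P]
  change _ = -(3 * (F p - D p) - 2 * c + (Module.finrank ℝ E - 4) * F p) * fderiv ℝ f p z
  linear_combination -hdiv' - (Module.finrank ℝ E - 2) * hdF
end Einstein

/-! ### Isometries -/

section Isometry

variable {E : Type*} [NormedAddCommGroup E] [NormedSpace ℝ E]

/-- The smooth map `τ` pulls the metric `G'` back to the metric `G` on the set `W`. -/
structure IsIsometryOn (τ : E → E) (G G' : E → E →L[ℝ] E →L[ℝ] ℝ) (W W' : Set E) : Prop where
  left : IsMetricOn G W
  right : IsMetricOn G' W'
  mapsTo : Set.MapsTo τ W W'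
  contDiffOn : ContDiffOn ℝ ∞ τ W
  pullback : ∀ y ∈ W, ∀ v w, G y v w = G' (τ y) (fderiv ℝ τ y v) (fderiv ℝ τ y w)

namespace IsIsometryOn

variable {τ : E → E} {G G' : E → E →L[ℝ] E →L[ℝ] ℝ} {W W' : Set E}

theorem contDiffAt (h : IsIsometryOn τ G G' W W') {y : E} (hy : y ∈ W) : ContDiffAt ℝ ∞ τ y :=
  h.contDiffOn.contDiffAt (h.left.isOpen.mem_nhds hy)

theorem injective_fderiv (h : IsIsometryOn τ G G' W W') {y : E} (hy : y ∈ W) :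
    Function.Injective (fderiv ℝ τ y) := fun a b hab =>
  h.left.eq_of_forall hy fun w => by rw [h.pullback y hy, h.pullback y hy, hab]

variable [FiniteDimensional ℝ E]

/-- The transformation law of the Christoffel symbols. -/
theorem fderiv_christoffel (h : IsIsometryOn τ G G' W W') {y : E} (hy : y ∈ W) (u v : E) :
    fderiv ℝ τ y (christoffel G y u v) =
      christoffel G' (τ y) (fderiv ℝ τ y u) (fderiv ℝ τ y v) + fderiv ℝ (fderiv ℝ τ) y u v := by
  have hy' := h.mapsTo hy
  let A : E ≃ₗ[ℝ] E := LinearEquiv.ofInjectiveEndo (fderiv ℝ τ y).toLinearMap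
    (h.injective_fderiv hy)
  have hA (v : E) : fderiv ℝ τ y (A.symm v) = v := A.apply_symm_apply v
  have hτ : DifferentiableAt ℝ τ y := (h.contDiffAt hy).differentiableAt (by simp)
  have hτ' : DifferentiableAt ℝ (fderiv ℝ τ) y :=
    ((h.contDiffOn.fderiv_of_isOpen h.left.isOpen (m := ∞) (by simp)).contDiffAt
      (h.left.isOpen.mem_nhds hy)).differentiableAt (by simp)
  have hs : IsSymmSndFDerivAt ℝ τ y := isSymmSndFDerivAt (h.contDiffAt hy)
  have key := h.left.christoffel_unique hy (S := fun u v => A.symm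
    (christoffel G' (τ y) (fderiv ℝ τ y u) (fderiv ℝ τ y v) + fderiv ℝ (fderiv ℝ τ) y u v))
    (fun u v => by simp only [h.right.christoffel_symm hy' (fderiv ℝ τ y u), hs.eq u v])
    (fun x v w => by
      have he : (fun z => G z v w) =ᶠ[nhds y]
          fun z => G' (τ z) (fderiv ℝ τ z v) (fderiv ℝ τ z w) := by
        filter_upwards [h.left.isOpen.mem_nhds hy] with z hz using h.pullback z hz v w
      have hG' : HasFDerivAt (fun z => G' (τ z)) (fderiv ℝ G' (τ y) ∘L fderiv ℝ τ y) y :=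
        (h.right.differentiableAt hy').hasFDerivAt.comp y hτ.hasFDerivAt
      rw [← fderiv_clm_apply₂ (h.left.differentiableAt hy), he.fderiv_eq,
        fderiv_bilin_apply hG'.differentiableAt (hτ'.clm_apply (differentiableAt_const _))
          (hτ'.clm_apply (differentiableAt_const _)), hG'.fderiv, fderiv_clm_apply₁ hτ',
        fderiv_clm_apply₁ hτ', ContinuousLinearMap.comp_apply, h.right.fderiv_eq hy',
        h.pullback y hy, h.pullback y hy, hA, hA]
      simp only [map_add, add_apply]
      ring) u v
  rw [key, hA]

/-- Vector fields which correspond to each other under an isometry have the same divergence. -/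
theorem divergence_eq (h : IsIsometryOn τ G G' W W') {Z Z' : E → E} {y : E} (hy : y ∈ W)
    (hZ : DifferentiableAt ℝ Z y) (hZ' : DifferentiableAt ℝ Z' (τ y))
    (hτZ : ∀ z ∈ W, Z' (τ z) = fderiv ℝ τ z (Z z)) :
    divergence G' Z' (τ y) = divergence G Z y := by
  let A : E ≃ₗ[ℝ] E := LinearEquiv.ofInjectiveEndo (fderiv ℝ τ y).toLinearMap
    (h.injective_fderiv hy)
  have hA (v : E) : fderiv ℝ τ y v = A v := rfl
  have hτ : DifferentiableAt ℝ τ y := (h.contDiffAt hy).differentiableAt (by simp)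
  have hτ' : DifferentiableAt ℝ (fderiv ℝ τ) y :=
    ((h.contDiffOn.fderiv_of_isOpen h.left.isOpen (m := ∞) (by simp)).contDiffAt
      (h.left.isOpen.mem_nhds hy)).differentiableAt (by simp)
  have key (v : E) : covDeriv G' Z' (τ y) (A v) = A (covDeriv G Z y v) := by
    have he : (fun z => Z' (τ z)) =ᶠ[nhds y] fun z => fderiv ℝ τ z (Z z) := by
      filter_upwards [h.left.isOpen.mem_nhds hy] with z hz using hτZ z hz
    have h1 : fderiv ℝ (fun z => Z' (τ z)) y v = fderiv ℝ Z' (τ y) (fderiv ℝ τ y v) :=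
      congrArg (fun L => L v) (hZ'.hasFDerivAt.comp y hτ.hasFDerivAt).fderiv
    have hs : IsSymmSndFDerivAt ℝ τ y := isSymmSndFDerivAt (h.contDiffAt hy)
    rw [he.fderiv_eq, fderiv_clm_apply hτ' hZ] at h1
    rw [covDeriv_apply, covDeriv_apply, ← hA, ← hA, ← h1, map_add, h.fderiv_christoffel hy,
      hτZ y hy]
    simp only [add_apply, ContinuousLinearMap.comp_apply, ContinuousLinearMap.flip_apply]
    abel
  have : (covDeriv G' Z' (τ y)).toLinearMap = A.conj (covDeriv G Z y).toLinearMap := by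
    ext v
    obtain ⟨v, rfl⟩ := A.surjective v
    simp [LinearEquiv.conj_apply, key]
  rw [divergence, this, LinearMap.trace_conj', divergence]

end IsIsometryOn

end Isometry

/-! ### The Riemannian density -/

section Density

variable {E : Type*} [NormedAddCommGroup E] [NormedSpace ℝ E] [FiniteDimensional ℝ E]

/-- The Gram matrix of the metric `G` at `y` in a fixed basis of `E`. -/
def gram (G : E → E →L[ℝ] E →L[ℝ] ℝ) (y : E) :
    Matrix (Fin (Module.finrank ℝ E)) (Fin (Module.finrank ℝ E)) ℝ :=
  Matrix.of fun i j => G y (Module.finBasis ℝ E i) (Module.finBasis ℝ E j)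

/-- The density `√(det G)` of the Riemannian volume with respect to the Lebesgue measure. -/
def density (G : E → E →L[ℝ] E →L[ℝ] ℝ) (y : E) : ℝ := √(gram G y).det

theorem toMatrix_transpose_mul_gram (G : E → E →L[ℝ] E →L[ℝ] ℝ) (y : E) (A : E →ₗ[ℝ] E)
    (i j : Fin (Module.finrank ℝ E)) :
    ((LinearMap.toMatrix (Module.finBasis ℝ E) (Module.finBasis ℝ E) A).transpose * gram G y) i j =
      G y (A (Module.finBasis ℝ E i)) (Module.finBasis ℝ E j) := by
  conv_rhs => rw [← (Module.finBasis ℝ E).sum_repr (A (Module.finBasis ℝ E i))]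
  simp [Matrix.mul_apply, gram, LinearMap.toMatrix_apply, -Module.Basis.sum_repr]

theorem gram_mul_toMatrix (G : E → E →L[ℝ] E →L[ℝ] ℝ) (y : E) (A : E →ₗ[ℝ] E)
    (i j : Fin (Module.finrank ℝ E)) :
    (gram G y * LinearMap.toMatrix (Module.finBasis ℝ E) (Module.finBasis ℝ E) A) i j =
      G y (Module.finBasis ℝ E i) (A (Module.finBasis ℝ E j)) := by
  conv_rhs => rw [← (Module.finBasis ℝ E).sum_repr (A (Module.finBasis ℝ E j))]
  simp [Matrix.mul_apply, gram, LinearMap.toMatrix_apply, mul_comm, -Module.Basis.sum_repr]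

theorem IsIsometryOn.density_eq {τ : E → E} {G G' : E → E →L[ℝ] E →L[ℝ] ℝ} {W W' : Set E}
    (h : IsIsometryOn τ G G' W W') {y : E} (hy : y ∈ W) :
    density G y = |(fderiv ℝ τ y).det| * density G' (τ y) := by
  set b := Module.finBasis ℝ E
  set C := LinearMap.toMatrix b b (fderiv ℝ τ y).toLinearMap with hC
  have h1 : gram G y = C.transpose * (gram G' (τ y) * C) := by
    ext i j
    have h2 : gram G' (τ y) * C = Matrix.of fun i j => G' (τ y) (b i) (fderiv ℝ τ y (b j)) := by
      ext i j; exact gram_mul_toMatrix G' (τ y) _ i j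
    have h3 := toMatrix_transpose_mul_gram
      (fun _ => (G' (τ y)).flip.comp (fderiv ℝ τ y) |>.flip) y (fderiv ℝ τ y).toLinearMap i j
    rw [h2]
    refine (h.pullback y hy _ _).trans h3.symm
  have h4 : (gram G y).det = (fderiv ℝ τ y).det ^ 2 * (gram G' (τ y)).det := by
    rw [h1, Matrix.det_mul, Matrix.det_mul, Matrix.det_transpose, hC, LinearMap.det_toMatrix]
    change _ = LinearMap.det (fderiv ℝ τ y).toLinearMap ^ 2 * _
    ring
  rw [density, h4, Real.sqrt_mul (sq_nonneg _), Real.sqrt_sq_eq_abs, density]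

/-- Jacobi's formula at an invertible matrix. -/
theorem hasDerivAt_det_add_smul {n : Type*} [Fintype n] [DecidableEq n] (A H : Matrix n n ℝ)
    (hA : IsUnit A.det) :
    HasDerivAt (fun t : ℝ => (A + t • H).det) (A.det * (A⁻¹ * H).trace) 0 := by
  have h1 : (fun t : ℝ => (A + t • H).det) = fun t => A.det *
      (1 + (A⁻¹ * H).trace * t + (Matrix.det (1 + (Polynomial.X : Polynomial ℝ) •
        (A⁻¹ * H).map Polynomial.C)).divX.divX.eval t * t ^ 2) := by
    ext t
    rw [← Matrix.det_one_add_smul, ← Matrix.det_mul, mul_add, mul_one, Matrix.mul_smul,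
      Matrix.mul_nonsing_inv_cancel_left _ _ hA]
  rw [h1]
  set q := (Matrix.det (1 + (Polynomial.X : Polynomial ℝ) •
        (A⁻¹ * H).map Polynomial.C)).divX.divX
  have := ((((hasDerivAt_id (0 : ℝ)).const_mul (A⁻¹ * H).trace).const_add 1).add
    ((q.hasDerivAt 0).mul ((hasDerivAt_id (0 : ℝ)).pow 2))).const_mul A.det
  exact this.congr_deriv (by simp)

theorem contDiff_det {n : Type*} [Fintype n] [DecidableEq n] {k : ℕ∞ω} :
    ContDiff ℝ k (fun A : n → n → ℝ => (Matrix.of A).det) := by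
  simp only [Matrix.det_apply]
  refine ContDiff.sum fun σ _ => ContDiff.const_smul _ (contDiff_prod fun i _ => ?_)
  exact contDiff_apply_apply ℝ ℝ (σ i) i

namespace IsMetricOn

variable {G : E → E →L[ℝ] E →L[ℝ] ℝ} {W : Set E}

theorem det_gram_pos (hG : IsMetricOn G W) {y : E} (hy : y ∈ W) : 0 < (gram G y).det := by
  refine Matrix.PosDef.det_pos (Matrix.PosDef.of_dotProduct_mulVec_pos ?_ ?_)
  · ext i j
    simp [gram, hG.symm y hy (Module.finBasis ℝ E i)]
  · intro x hx
    have h0 : ∑ i, x i • Module.finBasis ℝ E i ≠ 0 := by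
      intro h0
      apply hx
      ext i
      exact Fintype.linearIndependent_iff.1 (Module.finBasis ℝ E).linearIndependent x h0 i
    have := hG.pos y hy _ h0
    simp only [map_sum, map_smul, sum_apply, smul_apply, smul_eq_mul] at this
    refine this.trans_eq ?_
    simp only [dotProduct, Matrix.mulVec, gram, Finset.mul_sum, Matrix.of_apply, star_trivial]
    rw [Finset.sum_comm]
    refine Finset.sum_congr rfl fun i _ => Finset.sum_congr rfl fun j _ => ?_
    ring

theorem density_pos (hG : IsMetricOn G W) {y : E} (hy : y ∈ W) : 0 < density G y :=
  Real.sqrt_pos.2 (hG.det_gram_pos hy)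

theorem contDiffOn_gram (hG : IsMetricOn G W) :
    ContDiffOn ℝ ∞ (fun y i j => gram G y i j) W := by
  refine contDiffOn_pi.2 fun i => contDiffOn_pi.2 fun j => ?_
  exact (hG.contDiffOn.clm_apply contDiffOn_const).clm_apply contDiffOn_const

theorem contDiffOn_det_gram (hG : IsMetricOn G W) :
    ContDiffOn ℝ ∞ (fun y => (gram G y).det) W :=
  contDiff_det.comp_contDiffOn hG.contDiffOn_gram

theorem contDiffOn_density (hG : IsMetricOn G W) : ContDiffOn ℝ ∞ (density G) W :=
  hG.contDiffOn_det_gram.sqrt fun _ hy => (hG.det_gram_pos hy).ne'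

theorem fderiv_det_gram (hG : IsMetricOn G W) {y : E} (hy : y ∈ W) (x : E) :
    fderiv ℝ (fun y => (gram G y).det) y x =
      2 * (gram G y).det * LinearMap.trace ℝ E (christoffel G y x : E →L[ℝ] E) := by
  set b := Module.finBasis ℝ E with hb
  set C := LinearMap.toMatrix b b (christoffel G y x : E →L[ℝ] E).toLinearMap with hC
  set A := gram G y with hA
  set H : Matrix _ _ ℝ := C.transpose * A + A * C with hH
  have hu : IsUnit A.det := (hG.det_gram_pos hy).ne'.isUnit
  have hgram : HasFDerivAt (fun y i j => gram G y i j) _ y :=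
    ((hG.contDiffOn_gram.contDiffAt (hG.isOpen.mem_nhds hy)).differentiableAt
      (by simp)).hasFDerivAt
  have hval : fderiv ℝ (fun y i j => gram G y i j) y x = H := by
    ext i j
    have h1 := hasFDerivAt_pi'.1 (hasFDerivAt_pi'.1 hgram i) j
    have h2 := fderiv_clm_apply₂ (hG.differentiableAt hy) (b i) (b j) x
    have h3 : fderiv ℝ (fun y => gram G y i j) y x = H i j := by
      refine h2.trans ?_
      rw [hG.fderiv_eq hy, hH, Matrix.add_apply, hC, toMatrix_transpose_mul_gram,
        gram_mul_toMatrix]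
      rfl
    rw [← h3, h1.fderiv]
    rfl
  have hdet : DifferentiableAt ℝ (fun A : Fin (Module.finrank ℝ E) → Fin (Module.finrank ℝ E) → ℝ
      => (Matrix.of A).det) A := contDiff_det.differentiable (n := 1) (by simp) _
  have hline : HasDerivAt (fun t : ℝ => (A + t • H).det) (fderiv ℝ (fun A : Fin (Module.finrank ℝ E)
      → Fin (Module.finrank ℝ E) → ℝ => (Matrix.of A).det) A H) 0 :=
    hdet.hasFDerivAt.hasLineDerivAt H
  have htr : (A⁻¹ * H).trace = 2 * LinearMap.trace ℝ E (christoffel G y x : E →L[ℝ] E) := by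
    rw [hH, Matrix.mul_add, Matrix.nonsing_inv_mul_cancel_left _ _ hu, Matrix.trace_add,
      Matrix.trace_mul_comm, Matrix.mul_assoc, Matrix.mul_nonsing_inv _ hu, Matrix.mul_one,
      Matrix.trace_transpose, hC, LinearMap.trace_eq_matrix_trace ℝ b]
    ring
  have hcomp : HasFDerivAt (fun y => (gram G y).det) _ y :=
    HasFDerivAt.comp (g := fun A : Fin (Module.finrank ℝ E) → Fin (Module.finrank ℝ E) → ℝ
      => (Matrix.of A).det) y hdet.hasFDerivAt hgram
  rw [hcomp.fderiv, ContinuousLinearMap.comp_apply, hval,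
    hline.unique (hasDerivAt_det_add_smul A H hu), htr]
  ring

theorem fderiv_density (hG : IsMetricOn G W) {y : E} (hy : y ∈ W) (x : E) :
    fderiv ℝ (density G) y x =
      density G y * LinearMap.trace ℝ E (christoffel G y x : E →L[ℝ] E) := by
  have hd : DifferentiableAt ℝ (fun y => (gram G y).det) y :=
    (hG.contDiffOn_det_gram.contDiffAt (hG.isOpen.mem_nhds hy)).differentiableAt (by simp)
  have h : HasFDerivAt (density G) _ y := hd.hasFDerivAt.sqrt (hG.det_gram_pos hy).ne'
  rw [h.fderiv, smul_apply, hG.fderiv_det_gram hy, smul_eq_mul]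
  have h1 := Real.mul_self_sqrt (hG.det_gram_pos hy).le
  have h2 := hG.density_pos hy
  change 0 < √(gram G y).det at h2
  rw [density]
  field_simp
  rw [sq, h1]

end IsMetricOn
end Density

/-! ### Charts of a complex manifold -/

section Overlap

variable {E M : Type*} [TopologicalSpace E] [TopologicalSpace M]

/-- The change of coordinates from the chart `e` to the chart `e'`. -/
def transition (e e' : OpenPartialHomeomorph M E) (y : E) : E := e' (e.symm y)

/-- The set on which the change of coordinates from `e` to `e'` is meaningful. -/
def overlap (e e' : OpenPartialHomeomorph M E) : Set E := e.target ∩ e.symm ⁻¹' e'.source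

theorem isOpen_overlap (e e' : OpenPartialHomeomorph M E) : IsOpen (overlap e e') :=
  e.isOpen_inter_preimage_symm e'.open_source

theorem mapsTo_transition (e e' : OpenPartialHomeomorph M E) :
    Set.MapsTo (transition e e') (overlap e e') e'.target := fun _ hy => e'.map_source hy.2

theorem symm_transition {e e' : OpenPartialHomeomorph M E} {y : E} (hy : y ∈ overlap e e') :
    e'.symm (transition e e' y) = e.symm y := e'.left_inv hy.2

end Overlap

section Charts

variable {E : Type*} [NormedAddCommGroup E] [NormedSpace ℂ E]
variable {M : Type*} [TopologicalSpace M] [ChartedSpace E M]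

/-- The derivative at `y` of the inverse of the chart `e`, as an endomorphism of `E` (which is the
type of all tangent spaces). -/
def symmDeriv (e : OpenPartialHomeomorph M E) (y : E) : E →L[ℝ] E :=
  mfderiv 𝓘(ℝ, E) 𝓘(ℝ, E) e.symm y

/-- The expression in the chart `e` of a vector field `Z` on `M`. -/
def vecInChart (Z : ∀ x : M, TangentSpace 𝓘(ℝ, E) x) (e : OpenPartialHomeomorph M E) (y : E) : E :=
  (symmDeriv e y).inverse (Z (e.symm y) : E)

theorem formInChart_eq (h : ∀ x : M, TangentSpace 𝓘(ℝ, E) x →L[ℝ] TangentSpace 𝓘(ℝ, E) x →L[ℝ] ℝ)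
    (e : OpenPartialHomeomorph M E) (y u v : E) :
    formInChart h e y u v =
      (h (e.symm y) : E →L[ℝ] E →L[ℝ] ℝ) (symmDeriv e y u) (symmDeriv e y v) := rfl

theorem oneFormInChart_eq (θ : ∀ x : M, TangentSpace 𝓘(ℝ, E) x →L[ℝ] ℝ)
    (e : OpenPartialHomeomorph M E) (y v : E) :
    oneFormInChart θ e y v = (θ (e.symm y) : E →L[ℝ] ℝ) (symmDeriv e y v) := rfl

variable [IsManifold 𝓘(ℂ, E) ω M] {e e' : OpenPartialHomeomorph M E}

theorem contMDiffOn_symm (he : e ∈ atlas E M) :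
    ContMDiffOn 𝓘(ℝ, E) 𝓘(ℝ, E) ω e.symm e.target :=
  contMDiffOn_symm_of_mem_maximalAtlas (IsManifold.subset_maximalAtlas he)

theorem contMDiffOn_chart_of_mem (he : e ∈ atlas E M) :
    ContMDiffOn 𝓘(ℝ, E) 𝓘(ℝ, E) ω e e.source :=
  contMDiffOn_of_mem_maximalAtlas (IsManifold.subset_maximalAtlas he)

theorem mdifferentiableAt_symm (he : e ∈ atlas E M) {y : E} (hy : y ∈ e.target) :
    MDifferentiableAt 𝓘(ℝ, E) 𝓘(ℝ, E) e.symm y :=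
  ((contMDiffOn_symm he).contMDiffAt (e.open_target.mem_nhds hy)).mdifferentiableAt (by simp)

theorem mdifferentiableAt_of_mem_atlas (he : e ∈ atlas E M) {x : M} (hx : x ∈ e.source) :
    MDifferentiableAt 𝓘(ℝ, E) 𝓘(ℝ, E) e x :=
  ((contMDiffOn_chart_of_mem he).contMDiffAt (e.open_source.mem_nhds hx)).mdifferentiableAt
    (by simp)

theorem isInvertible_symmDeriv (he : e ∈ atlas E M) {y : E} (hy : y ∈ e.target) :
    (symmDeriv e y).IsInvertible := by
  have h : e.MDifferentiable 𝓘(ℝ, E) 𝓘(ℝ, E) :=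
    ⟨fun x hx => (mdifferentiableAt_of_mem_atlas he hx).mdifferentiableWithinAt,
      fun x hx => (mdifferentiableAt_symm he hx).mdifferentiableWithinAt⟩
  exact ⟨h.symm.mfderiv hy, rfl⟩

/-- In a holomorphic chart, the derivative of the inverse of the chart is complex linear. -/
theorem symmDeriv_I_smul (he : e ∈ atlas E M) {y : E} (hy : y ∈ e.target) (v : E) :
    symmDeriv e y (Complex.I • v) = Complex.I • symmDeriv e y v := by
  have h1 : MDifferentiableAt 𝓘(ℂ, E) 𝓘(ℂ, E) e.symm y :=
    mdifferentiableAt_atlas_symm (I := 𝓘(ℂ, E)) he hy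
  obtain ⟨hc, hd⟩ := h1.hasMFDerivAt
  have h2 : HasMFDerivAt 𝓘(ℝ, E) 𝓘(ℝ, E) e.symm y
      ((mfderiv 𝓘(ℂ, E) 𝓘(ℂ, E) e.symm y : E →L[ℂ] E).restrictScalars ℝ) :=
    ⟨hc, hd.restrictScalars ℝ⟩
  rw [symmDeriv, h2.mfderiv]
  exact (mfderiv 𝓘(ℂ, E) 𝓘(ℂ, E) e.symm y : E →L[ℂ] E).map_smul Complex.I v

theorem contDiffOn_transition (he : e ∈ atlas E M) (he' : e' ∈ atlas E M) :
    ContDiffOn ℝ ω (transition e e') (overlap e e') := by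
  rw [← contMDiffOn_iff_contDiffOn]
  exact (contMDiffOn_chart_of_mem he').comp ((contMDiffOn_symm he).mono Set.inter_subset_left)
    fun y hy => hy.2

theorem symmDeriv_eq (he : e ∈ atlas E M) (he' : e' ∈ atlas E M) {y : E} (hy : y ∈ overlap e e')
    (v : E) :
    symmDeriv e y v = symmDeriv e' (transition e e' y) (fderiv ℝ (transition e e') y v) := by
  have h1 : (fun z => e'.symm (transition e e' z)) =ᶠ[nhds y] e.symm := by
    filter_upwards [(isOpen_overlap e e').mem_nhds hy] with z hz using symm_transition hz
  have h2 : MDifferentiableAt 𝓘(ℝ, E) 𝓘(ℝ, E) (transition e e') y := by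
    rw [mdifferentiableAt_iff_differentiableAt]
    exact ((contDiffOn_transition he he').contDiffAt
      ((isOpen_overlap e e').mem_nhds hy)).differentiableAt (by simp)
  have h3 := mfderiv_comp y (mdifferentiableAt_symm he' (mapsTo_transition e e' hy)) h2
  rw [mfderiv_eq_fderiv] at h3
  have h4 : mfderiv 𝓘(ℝ, E) 𝓘(ℝ, E) (e'.symm ∘ transition e e') y =
      mfderiv 𝓘(ℝ, E) 𝓘(ℝ, E) e.symm y := h1.mfderiv_eq
  have h5 := h4.symm.trans h3
  exact congrArg (fun L : E →L[ℝ] E => L v) h5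

theorem symmDeriv_vecInChart (he : e ∈ atlas E M) (Z : ∀ x : M, TangentSpace 𝓘(ℝ, E) x) {y : E}
    (hy : y ∈ e.target) : symmDeriv e y (vecInChart Z e y) = Z (e.symm y) :=
  (isInvertible_symmDeriv he hy).self_apply_inverse _

theorem vecInChart_transition (he : e ∈ atlas E M) (he' : e' ∈ atlas E M)
    (Z : ∀ x : M, TangentSpace 𝓘(ℝ, E) x) {y : E} (hy : y ∈ overlap e e') :
    vecInChart Z e' (transition e e' y) = fderiv ℝ (transition e e') y (vecInChart Z e y) := by
  have hy' := mapsTo_transition e e' hy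
  apply (isInvertible_symmDeriv he' hy').injective
  rw [symmDeriv_vecInChart he' Z hy', ← symmDeriv_eq he he' hy, symmDeriv_vecInChart he Z hy.1,
    symm_transition hy]

theorem formInChart_fundamentalForm
    (h : ∀ x : M, TangentSpace 𝓘(ℝ, E) x →L[ℝ] TangentSpace 𝓘(ℝ, E) x →L[ℝ] ℝ)
    (he : e ∈ atlas E M) {y : E} (hy : y ∈ e.target) (u v : E) :
    formInChart (fundamentalForm h) e y u v = formInChart h e y (Complex.I • u) v := by
  rw [formInChart_eq, formInChart_eq, symmDeriv_I_smul he hy]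
  rfl

theorem formInChart_hermitian
    {h : ∀ x : M, TangentSpace 𝓘(ℝ, E) x →L[ℝ] TangentSpace 𝓘(ℝ, E) x →L[ℝ] ℝ}
    {U : Set M} (hh : IsHermitianOn h U) (he : e ∈ atlas E M) {y : E} (hy : y ∈ e.target)
    (hU : e.symm y ∈ U) (u v : E) :
    formInChart h e y (Complex.I • u) (Complex.I • v) = formInChart h e y u v := by
  rw [formInChart_eq, formInChart_eq, symmDeriv_I_smul he hy, symmDeriv_I_smul he hy]
  exact hh _ hU _ _

theorem contDiffOn_formInChart [FiniteDimensional ℂ E] (g : Metric E M) (he : e ∈ atlas E M) :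
    ContDiffOn ℝ ∞ (formInChart g.inner e) e.target := by
  have : FiniteDimensional ℝ E := FiniteDimensional.complexToReal E
  refine contDiffOn_clm_apply.2 fun u => contDiffOn_clm_apply.2 fun v => ?_
  -- the coordinate vector fields of the chart are smooth
  have hs (u : E) : ContMDiffOn 𝓘(ℝ, E) 𝓘(ℝ, E).tangent ∞
      (fun y => (⟨e.symm y, mfderiv 𝓘(ℝ, E) 𝓘(ℝ, E) e.symm y u⟩ : TangentBundle 𝓘(ℝ, E) M))
      e.target := by
    have h1 := (contMDiffOn_symm he).contMDiffOn_tangentMapWithin (m := ∞) (by simp)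
      e.open_target.uniqueMDiffOn
    have h2 : ContMDiffOn 𝓘(ℝ, E) 𝓘(ℝ, E).tangent ∞
        (fun y : E => (⟨y, u⟩ : TangentBundle 𝓘(ℝ, E) E)) e.target :=
      contMDiffOn_vectorSpace_iff_contDiffOn.2 contDiffOn_const
    refine (h1.comp h2 fun y hy => hy).congr fun y hy => ?_
    simp only [Function.comp_apply, tangentMapWithin,
      mfderivWithin_of_isOpen e.open_target hy]
  have h3 : ContMDiffOn 𝓘(ℝ, E) (𝓘(ℝ, E).prod 𝓘(ℝ)) ∞
      (fun y => Bundle.TotalSpace.mk' ℝ (E := Bundle.Trivial M ℝ) (e.symm y)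
        (g.inner (e.symm y) (mfderiv 𝓘(ℝ, E) 𝓘(ℝ, E) e.symm y u)
          (mfderiv 𝓘(ℝ, E) 𝓘(ℝ, E) e.symm y v))) e.target := by
    apply ContMDiffOn.clm_bundle_apply₂ (F₁ := E) (F₂ := E)
    · exact g.contMDiff.comp_contMDiffOn ((contMDiffOn_symm he).of_le (by simp))
    · exact hs u
    · exact hs v
  rw [← contMDiffOn_iff_contDiffOn]
  intro y hy
  have h4 := h3 y hy
  simp only [Bundle.contMDiffWithinAt_totalSpace] at h4
  exact h4.2

theorem isMetricOn_formInChart [FiniteDimensional ℂ E] (g : Metric E M) (he : e ∈ atlas E M) :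
    IsMetricOn (formInChart g.inner e) e.target where
  isOpen := e.open_target
  contDiffOn := contDiffOn_formInChart g he
  symm y _ v w := by
    rw [formInChart_eq, formInChart_eq]
    exact g.symm (e.symm y) _ _
  pos y hy v hv := by
    rw [formInChart_eq]
    refine g.pos (e.symm y) (symmDeriv e y v) fun h => hv ?_
    exact (isInvertible_symmDeriv he hy).injective (h.trans (map_zero (symmDeriv e y)).symm)

theorem isIsometryOn_transition [FiniteDimensional ℂ E] (g : Metric E M) (he : e ∈ atlas E M)
    (he' : e' ∈ atlas E M) : IsIsometryOn (transition e e') (formInChart g.inner e)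
      (formInChart g.inner e') (overlap e e') e'.target where
  left := (isMetricOn_formInChart g he).mono (isOpen_overlap e e') Set.inter_subset_left
  right := isMetricOn_formInChart g he'
  mapsTo := mapsTo_transition e e'
  contDiffOn := (contDiffOn_transition he he').of_le (by simp)
  pullback y hy v w := by
    rw [formInChart_eq, formInChart_eq, symmDeriv_eq he he' hy, symmDeriv_eq he he' hy,
      symm_transition hy]

end Charts

/-! ### Functions supported in a chart -/

section Support

variable {E M : Type*} [NormedAddCommGroup E] [TopologicalSpace M]

theorem tsupport_subset_of_forall {f ψ : E → ℝ} (h : ∀ y ∉ tsupport ψ, f y = 0) :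
    tsupport f ⊆ tsupport ψ :=
  closure_minimal (fun y hy => by_contra fun h' => hy (h y h')) (isClosed_tsupport ψ)

/-- The function `h` on `M` read in the chart `e`, extended by zero outside of the target. -/
def pullToChart (e : OpenPartialHomeomorph M E) (h : M → ℝ) : E → ℝ :=
  e.target.indicator fun y => h (e.symm y)

theorem tsupport_pullToChart [T2Space M] [CompactSpace M] {e : OpenPartialHomeomorph M E}
    {h : M → ℝ} (hs : tsupport h ⊆ e.source) :
    HasCompactSupport (pullToChart e h) ∧ tsupport (pullToChart e h) ⊆ e.target := by
  have hK : IsCompact (e '' tsupport h) :=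
    (isClosed_tsupport h).isCompact.image_of_continuousOn (e.continuousOn.mono hs)
  have hsub : Function.support (pullToChart e h) ⊆ e '' tsupport h := by
    intro y hy
    have hy' : y ∈ e.target := by
      by_contra h'
      exact hy (Set.indicator_of_notMem h' _)
    have hy2 : h (e.symm y) ≠ 0 := by
      rwa [Function.mem_support, pullToChart, Set.indicator_of_mem hy'] at hy
    exact ⟨e.symm y, subset_closure hy2, e.right_inv hy'⟩
  have ht := closure_minimal hsub hK.isClosed
  refine ⟨HasCompactSupport.of_support_subset_isCompact hK hsub, ht.trans ?_⟩
  rintro _ ⟨x, hx, rfl⟩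
  exact e.map_source (hs hx)

theorem pullToChart_eqOn (e : OpenPartialHomeomorph M E) (h : M → ℝ) :
    Set.EqOn (pullToChart e h) (fun y => h (e.symm y)) e.target :=
  fun _ hy => Set.indicator_of_mem hy _

end Support

/-! ### Integration by parts for the divergence -/

section Integration

open MeasureTheory

variable {E : Type*} [NormedAddCommGroup E] [NormedSpace ℝ E]

theorem contDiff_of_tsupport_subset {F : Type*} [NormedAddCommGroup F] [NormedSpace ℝ F]
    {f : E → F} {W : Set E} {n : ℕ∞ω} (hf : ContDiffOn ℝ n f W) (hW : IsOpen W)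
    (h : tsupport f ⊆ W) : ContDiff ℝ n f := by
  refine contDiff_iff_contDiffAt.2 fun x => ?_
  by_cases hx : x ∈ W
  · exact hf.contDiffAt (hW.mem_nhds hx)
  · have h0 : f =ᶠ[nhds x] fun _ => 0 := notMem_tsupport_iff_eventuallyEq.1 fun h' => hx (h h')
    exact contDiffAt_const.congr_of_eventuallyEq h0

theorem continuous_of_tsupport_subset {f : E → ℝ} {W : Set E} (hf : ContinuousOn f W)
    (hW : IsOpen W) (h : tsupport f ⊆ W) : Continuous f :=
  (contDiff_of_tsupport_subset (contDiffOn_zero.2 hf) hW h).continuous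

section

variable [FiniteDimensional ℝ E]

theorem IsMetricOn.differentiableAt_density {G : E → E →L[ℝ] E →L[ℝ] ℝ} {W : Set E}
    (hG : IsMetricOn G W) {y : E} (hy : y ∈ W) : DifferentiableAt ℝ (density G) y :=
  (hG.contDiffOn_density.contDiffAt (hG.isOpen.mem_nhds hy)).differentiableAt (by simp)

theorem IsMetricOn.continuousOn_divergence {G : E → E →L[ℝ] E →L[ℝ] ℝ} {W : Set E}
    (hG : IsMetricOn G W) {Z : E → E} (hZ : ContDiffOn ℝ 1 Z W) :
    ContinuousOn (divergence G Z) W := by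
  rw [← contDiffOn_zero (𝕜 := ℝ)]
  refine contDiffOn_trace (contDiffOn_zero.2 ?_)
  have h1 : ContinuousOn (fun y => (christoffel G y).flip) W :=
    (ContinuousLinearMap.flipₗᵢ ℝ E E E).continuous.comp_continuousOn
      hG.contDiffOn_christoffel.continuousOn
  exact (hZ.continuousOn_fderiv_of_isOpen hG.isOpen (by simp)).add (h1.clm_apply hZ.continuousOn)

end

variable [FiniteDimensional ℝ E] [MeasurableSpace E] [BorelSpace E]

theorem integral_trace_fderiv_eq_zero (μ : Measure E) [μ.IsAddHaarMeasure] {Y : E → E}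
    (hY : ContDiff ℝ 1 Y) (hc : HasCompactSupport Y) :
    ∫ y, LinearMap.trace ℝ E (fderiv ℝ Y y : E →L[ℝ] E) ∂μ = 0 := by
  let b := Module.finBasis ℝ E
  let c : Fin (Module.finrank ℝ E) → E →L[ℝ] ℝ := fun i => (b.coord i).toContinuousLinearMap
  have hcY (i) : ContDiff ℝ 1 (fun y => c i (Y y)) := (c i).contDiff.comp hY
  have hcs (i) : HasCompactSupport (fun y => c i (Y y)) := hc.comp_left (map_zero (c i))
  have hd (i) (y : E) : fderiv ℝ (fun y => c i (Y y)) y = c i ∘L fderiv ℝ Y y :=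
    ((c i).hasFDerivAt.comp y (hY.differentiable (by simp) y).hasFDerivAt).fderiv
  have hcont (i) : Continuous (fun y => fderiv ℝ (fun y => c i (Y y)) y (b i)) :=
    ((hcY i).continuous_fderiv (by simp)).clm_apply continuous_const
  have hsupp (i) : HasCompactSupport (fun y => fderiv ℝ (fun y => c i (Y y)) y (b i)) :=
    (hcs i).fderiv_apply ℝ (b i)
  have htr (y : E) : LinearMap.trace ℝ E (fderiv ℝ Y y : E →L[ℝ] E) =
      ∑ i, fderiv ℝ (fun y => c i (Y y)) y (b i) := by
    rw [LinearMap.trace_eq_matrix_trace ℝ b]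
    simp only [hd]
    simp [Matrix.trace, LinearMap.toMatrix_apply, c]
  simp only [htr]
  rw [integral_finsetSum _ fun i _ => (hcont i).integrable_of_hasCompactSupport (hsupp i)]
  refine Finset.sum_eq_zero fun i _ => ?_
  have := integral_mul_fderiv_eq_neg_fderiv_mul_of_integrable (μ := μ) (𝕜 := ℝ)
    (f := fun _ : E => (1 : ℝ)) (g := fun y => c i (Y y)) (v := b i) (by simp)
    (by simpa using (hcont i).integrable_of_hasCompactSupport (hsupp i))
    (by simpa using (hcY i).continuous.integrable_of_hasCompactSupport (hcs i))
    (fun x _ => differentiableAt_const _) (fun x _ => (hcY i).differentiable (by simp) x)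
  simpa using this

/-- Integration by parts for the Riemannian divergence, in an open subset of `E`. -/
theorem integral_mul_divergence (μ : Measure E) [μ.IsAddHaarMeasure]
    {G : E → E →L[ℝ] E →L[ℝ] ℝ} {W : Set E} (hG : IsMetricOn G W) {Z : E → E}
    (hZ : ContDiffOn ℝ 1 Z W) {ψ : E → ℝ} (hψ : ContDiff ℝ 1 ψ) (hc : HasCompactSupport ψ)
    (hs : tsupport ψ ⊆ W) :
    ∫ y, ψ y * divergence G Z y * density G y ∂μ = -∫ y, fderiv ℝ ψ y (Z y) * density G y ∂μ := by
  have hψ0 (y : E) (hy : y ∉ tsupport ψ) : ψ y = 0 := image_eq_zero_of_notMem_tsupport hy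
  have hψ1 (y : E) (hy : y ∉ tsupport ψ) : fderiv ℝ ψ y = 0 :=
    Function.notMem_support.1 fun h => hy (support_fderiv_subset ℝ h)
  have hw : ContDiffOn ℝ 1 (density G) W := hG.contDiffOn_density.of_le (by simp)
  let Y : E → E := fun y => (ψ y * density G y) • Z y
  have hYs : tsupport Y ⊆ tsupport ψ :=
    closure_minimal (fun y hy => by_contra fun h' => hy (by simp [Y, hψ0 y h']))
      (isClosed_tsupport ψ)
  have hY : ContDiff ℝ 1 Y :=
    contDiff_of_tsupport_subset ((hψ.contDiffOn.mul hw).smul hZ) hG.isOpen (hYs.trans hs)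
  have hYc : HasCompactSupport Y := hc.mono' (subset_closure.trans hYs)
  have h0 := integral_trace_fderiv_eq_zero μ hY hYc
  have hint {f : E → ℝ} (hf : ContinuousOn f W) (h : ∀ y ∉ tsupport ψ, f y = 0) :
      Integrable f μ :=
    (continuous_of_tsupport_subset hf hG.isOpen
      ((tsupport_subset_of_forall h).trans hs)).integrable_of_hasCompactSupport
      (hc.mono' (subset_closure.trans (tsupport_subset_of_forall h)))
  have hi1 : Integrable (fun y => ψ y * divergence G Z y * density G y) μ :=
    hint ((hψ.continuous.continuousOn.mul (hG.continuousOn_divergence hZ)).mul hw.continuousOn)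
      fun y hy => by simp [hψ0 y hy]
  have hi2 : Integrable (fun y => fderiv ℝ ψ y (Z y) * density G y) μ :=
    hint ((((hψ.continuous_fderiv (by simp)).continuousOn).clm_apply hZ.continuousOn).mul
      hw.continuousOn) fun y hy => by simp [hψ1 y hy]
  have htr : ∀ y, LinearMap.trace ℝ E (fderiv ℝ Y y : E →L[ℝ] E) =
      ψ y * divergence G Z y * density G y + fderiv ℝ ψ y (Z y) * density G y := by
    intro y
    by_cases hy : y ∈ tsupport ψ
    · have hyW := hs hy
      have hZy : DifferentiableAt ℝ Z y :=
        (hZ.contDiffAt (hG.isOpen.mem_nhds hyW)).differentiableAt (by simp)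
      have hd : HasFDerivAt Y _ y := ((hψ.differentiable (by simp) y).hasFDerivAt.mul
        (hG.differentiableAt_density hyW).hasFDerivAt).smul hZy.hasFDerivAt
      have h1 : (fderiv ℝ Y y : E →L[ℝ] E).toLinearMap =
          (ψ y * density G y) • (fderiv ℝ Z y : E →L[ℝ] E).toLinearMap
          + (ψ y • fderiv ℝ (density G) y + density G y • fderiv ℝ ψ y).toLinearMap.smulRight
            (Z y) := by
        rw [hd.fderiv]; rfl
      have h2 : (covDeriv G Z y).toLinearMap = (fderiv ℝ Z y : E →L[ℝ] E).toLinearMap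
          + (christoffel G y (Z y) : E →L[ℝ] E).toLinearMap := by
        ext v
        simp [covDeriv_apply, hG.christoffel_symm hyW v]
      rw [h1, divergence, h2]
      simp only [map_add, map_smul, LinearMap.trace_smulRight, ContinuousLinearMap.coe_coe,
        add_apply, smul_apply, smul_eq_mul, hG.fderiv_density hyW]
      ring
    · have hY0 : fderiv ℝ Y y = 0 :=
        Function.notMem_support.1 fun h => hy (hYs (support_fderiv_subset ℝ h))
      simp [hY0, hψ0 y hy, hψ1 y hy]
  simp only [htr] at h0
  rw [integral_add hi1 hi2] at h0
  linarith

end Integration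

/-! ### Integrals over the domain of a chart -/

section DivergenceTheorem

open MeasureTheory

variable {E : Type*} [NormedAddCommGroup E] [NormedSpace ℂ E] [FiniteDimensional ℂ E]
variable {M : Type*} [TopologicalSpace M] [ChartedSpace E M] [IsManifold 𝓘(ℂ, E) ω M]

/-- The integral of the function `h` over the domain of the chart `e`, for the Riemannian volume. -/
def chartIntegral [MeasurableSpace E] (μ : Measure E) (g : Metric E M)
    (e : OpenPartialHomeomorph M E) (h : M → ℝ) : ℝ :=
  ∫ y, pullToChart e h y * density (formInChart g.inner e) y ∂μ

theorem continuous_pullToChart_mul [T2Space M] [CompactSpace M] (g : Metric E M)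
    {e : OpenPartialHomeomorph M E} (he : e ∈ atlas E M) {h : M → ℝ} (hc : Continuous h)
    (hs : tsupport h ⊆ e.source) :
    Continuous (fun y => pullToChart e h y * density (formInChart g.inner e) y) ∧
      HasCompactSupport (fun y => pullToChart e h y * density (formInChart g.inner e) y) := by
  have : FiniteDimensional ℝ E := FiniteDimensional.complexToReal E
  obtain ⟨h1, h2⟩ := tsupport_pullToChart hs
  refine ⟨continuous_of_tsupport_subset (W := e.target) ?_ e.open_target
    ((closure_mono (Function.support_mul_subset_left _ _)).trans h2), h1.mul_right⟩
  refine ContinuousOn.mul ?_ (isMetricOn_formInChart g he).contDiffOn_density.continuousOn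
  exact (hc.comp_continuousOn e.continuousOn_symm).congr (pullToChart_eqOn e h)

variable [MeasurableSpace E] [BorelSpace E] (μ : Measure E) [μ.IsAddHaarMeasure]

theorem chartIntegral_sum [T2Space M] [CompactSpace M] (g : Metric E M)
    {e : OpenPartialHomeomorph M E} (he : e ∈ atlas E M) {ι : Type*} (s : Finset ι) {h : ι → M → ℝ}
    (hc : ∀ i ∈ s, Continuous (h i)) (hs : ∀ i ∈ s, tsupport (h i) ⊆ e.source) :
    chartIntegral μ g e (fun x => ∑ i ∈ s, h i x) = ∑ i ∈ s, chartIntegral μ g e (h i) := by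
  simp only [chartIntegral]
  rw [← integral_finsetSum s fun i hi =>
    (continuous_pullToChart_mul g he (hc i hi) (hs i hi)).1.integrable_of_hasCompactSupport
      (continuous_pullToChart_mul g he (hc i hi) (hs i hi)).2]
  congr 1
  ext y
  rw [← Finset.sum_mul]
  congr 1
  by_cases hy : y ∈ e.target
  · simp [pullToChart, hy]
  · simp [pullToChart, hy]

/-- The integral of a function supported in the domains of two charts can be computed in either. -/
theorem chartIntegral_eq (g : Metric E M) {e e' : OpenPartialHomeomorph M E} (he : e ∈ atlas E M)
    (he' : e' ∈ atlas E M) {h : M → ℝ} (hs : ∀ x, h x ≠ 0 → x ∈ e.source ∩ e'.source) :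
    chartIntegral μ g e h = chartIntegral μ g e' h := by
  have : FiniteDimensional ℝ E := FiniteDimensional.complexToReal E
  have hτ := isIsometryOn_transition g he he'
  have hopen := isOpen_overlap e e'
  have himage : transition e e' '' overlap e e' = overlap e' e := by
    ext z
    constructor
    · rintro ⟨y, hy, rfl⟩
      refine ⟨mapsTo_transition e e' hy, ?_⟩
      rw [Set.mem_preimage, symm_transition hy]
      exact e.map_target hy.1
    · intro hz
      refine ⟨transition e' e z, ⟨mapsTo_transition e' e hz, ?_⟩, ?_⟩
      · rw [Set.mem_preimage, symm_transition hz]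
        exact e'.map_target hz.1
      · rw [transition, symm_transition hz, e'.right_inv hz.1]
  have hind (e e' : OpenPartialHomeomorph M E) (hs : ∀ x, h x ≠ 0 → x ∈ e'.source) :
      chartIntegral μ g e h =
        ∫ y in overlap e e', h (e.symm y) * density (formInChart g.inner e) y ∂μ := by
    rw [chartIntegral, ← integral_indicator (isOpen_overlap e e').measurableSet]
    congr 1
    ext y
    by_cases hy : y ∈ overlap e e'
    · rw [Set.indicator_of_mem hy, pullToChart, Set.indicator_of_mem hy.1]
    · rw [Set.indicator_of_notMem hy]
      by_cases hy' : y ∈ e.target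
      · have : h (e.symm y) = 0 := by
          by_contra h0
          exact hy ⟨hy', hs _ h0⟩
        rw [pullToChart, Set.indicator_of_mem hy', this, zero_mul]
      · rw [pullToChart, Set.indicator_of_notMem hy', zero_mul]
  rw [hind e e' fun x hx => (hs x hx).2, hind e' e fun x hx => (hs x hx).1, ← himage,
    integral_image_eq_integral_abs_det_fderiv_smul μ hopen.measurableSet
      (fun y hy => ((hτ.contDiffAt hy).differentiableAt (by simp)).hasFDerivAt.hasFDerivWithinAt)
      (fun y hy z hz hyz => by
        apply e.symm.injOn hy.1 hz.1
        rw [← symm_transition hy, ← symm_transition hz, hyz])]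
  refine setIntegral_congr_fun hopen.measurableSet fun y hy => ?_
  simp only [symm_transition hy, hτ.density_eq hy, smul_eq_mul]
  ring

end DivergenceTheorem

/-! ### The divergence theorem on a compact manifold -/

section DivergenceOnManifold

open MeasureTheory

section

variable {E M : Type*} [TopologicalSpace E] [TopologicalSpace M] [ChartedSpace E M]

theorem continuous_of_charts {q : M → ℝ}
    (hq : ∀ e ∈ atlas E M, ContinuousOn (fun y => q (e.symm y)) e.target) : Continuous q := by
  refine continuous_iff_continuousAt.2 fun x => ?_
  let e := chartAt E x
  have hx : x ∈ e.source := mem_chart_source E x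
  have h1 : ContinuousAt (fun y => q (e.symm y)) (e x) :=
    (hq e (chart_mem_atlas E x)).continuousAt (e.open_target.mem_nhds (e.map_source hx))
  refine (ContinuousAt.comp (f := e) h1 (e.continuousAt hx)).congr ?_
  filter_upwards [e.open_source.mem_nhds hx] with z hz
  simp [e.left_inv hz]

end

variable {E : Type*} [NormedAddCommGroup E] [NormedSpace ℂ E]
variable {M : Type*} [TopologicalSpace M] [ChartedSpace E M]

/-- The derivative of the function `h` along the vector field `Z`. -/
def dirDeriv (h : M → ℝ) (Z : ∀ x : M, TangentSpace 𝓘(ℝ, E) x) (x : M) : ℝ :=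
  (mfderiv 𝓘(ℝ, E) 𝓘(ℝ, ℝ) h x : E →L[ℝ] ℝ) (Z x)

/-- The divergence of the vector field `Z` on the Riemannian manifold `(M, g)`, computed at each
point in the preferred chart (see `mdivergence_eq` for the other charts). -/
def mdivergence [IsManifold 𝓘(ℂ, E) ω M] (g : Metric E M) (Z : ∀ x : M, TangentSpace 𝓘(ℝ, E) x)
    (x : M) : ℝ :=
  divergence (formInChart g.inner (chartAt E x)) (vecInChart Z (chartAt E x)) (chartAt E x x)

theorem tsupport_dirDeriv_subset (h : M → ℝ) (Z : ∀ x : M, TangentSpace 𝓘(ℝ, E) x) :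
    tsupport (dirDeriv h Z) ⊆ tsupport h := by
  refine closure_minimal (fun x hx => by_contra fun hx' => hx ?_) (isClosed_tsupport h)
  have h0 : h =ᶠ[nhds x] fun _ => (0 : ℝ) := notMem_tsupport_iff_eventuallyEq.1 hx'
  rw [dirDeriv, h0.mfderiv_eq, mfderiv_const]
  rfl

variable [IsManifold 𝓘(ℂ, E) ω M]

theorem contDiffOn_comp_symm {e : OpenPartialHomeomorph M E} (he : e ∈ atlas E M) {h : M → ℝ}
    {n : ℕ∞ω} (hh : ContMDiff 𝓘(ℝ, E) 𝓘(ℝ, ℝ) n h) :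
    ContDiffOn ℝ n (fun y => h (e.symm y)) e.target := by
  rw [← contMDiffOn_iff_contDiffOn]
  exact hh.comp_contMDiffOn ((contMDiffOn_symm he).of_le le_top)

theorem fderiv_comp_symm {e : OpenPartialHomeomorph M E} (he : e ∈ atlas E M) {h : M → ℝ} {y : E}
    (hy : y ∈ e.target) (hh : MDifferentiableAt 𝓘(ℝ, E) 𝓘(ℝ, ℝ) h (e.symm y)) (v : E) :
    fderiv ℝ (fun y => h (e.symm y)) y v =
      (mfderiv 𝓘(ℝ, E) 𝓘(ℝ, ℝ) h (e.symm y) : E →L[ℝ] ℝ) (symmDeriv e y v) := by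
  have h3 := mfderiv_comp y hh (mdifferentiableAt_symm he hy)
  rw [mfderiv_eq_fderiv] at h3
  exact congrArg (fun L : E →L[ℝ] ℝ => L v) h3

theorem fderiv_comp_symm_vecInChart {e : OpenPartialHomeomorph M E} (he : e ∈ atlas E M)
    {h : M → ℝ} {y : E} (hy : y ∈ e.target)
    (hh : MDifferentiableAt 𝓘(ℝ, E) 𝓘(ℝ, ℝ) h (e.symm y)) (Z : ∀ x : M, TangentSpace 𝓘(ℝ, E) x) :
    fderiv ℝ (fun y => h (e.symm y)) y (vecInChart Z e y) = dirDeriv h Z (e.symm y) := by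
  rw [fderiv_comp_symm he hy hh, symmDeriv_vecInChart he Z hy, dirDeriv]

theorem continuous_dirDeriv {h : M → ℝ} (hh : ContMDiff 𝓘(ℝ, E) 𝓘(ℝ, ℝ) 1 h)
    {Z : ∀ x : M, TangentSpace 𝓘(ℝ, E) x}
    (hZ : ∀ e ∈ atlas E M, ContDiffOn ℝ 1 (vecInChart Z e) e.target) :
    Continuous (dirDeriv h Z) := by
  refine continuous_of_charts (E := E) fun e he => ?_
  have h1 := (contDiffOn_comp_symm he hh).continuousOn_fderiv_of_isOpen e.open_target (by simp)
  refine (h1.clm_apply (hZ e he).continuousOn).congr fun y hy => ?_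
  exact (fderiv_comp_symm_vecInChart he hy (hh.mdifferentiableAt (by simp)) Z).symm

variable [FiniteDimensional ℂ E]

theorem mdivergence_eq (g : Metric E M) {Z : ∀ x : M, TangentSpace 𝓘(ℝ, E) x}
    (hZ : ∀ e ∈ atlas E M, ContDiffOn ℝ 1 (vecInChart Z e) e.target)
    {e : OpenPartialHomeomorph M E} (he : e ∈ atlas E M) {y : E} (hy : y ∈ e.target) :
    mdivergence g Z (e.symm y) = divergence (formInChart g.inner e) (vecInChart Z e) y := by
  have : FiniteDimensional ℝ E := FiniteDimensional.complexToReal E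
  set e' := chartAt E (e.symm y) with he'def
  have he' : e' ∈ atlas E M := chart_mem_atlas E _
  have hy' : y ∈ overlap e e' := ⟨hy, mem_chart_source E _⟩
  have hd {e : OpenPartialHomeomorph M E} (he : e ∈ atlas E M) {y : E} (hy : y ∈ e.target) :
      DifferentiableAt ℝ (vecInChart Z e) y :=
    ((hZ e he).contDiffAt (e.open_target.mem_nhds hy)).differentiableAt (by simp)
  exact (isIsometryOn_transition g he he').divergence_eq hy' (hd he hy)
    (hd he' (mapsTo_transition e e' hy')) fun z hz => vecInChart_transition he he' Z hz

theorem continuous_mdivergence (g : Metric E M) {Z : ∀ x : M, TangentSpace 𝓘(ℝ, E) x}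
    (hZ : ∀ e ∈ atlas E M, ContDiffOn ℝ 1 (vecInChart Z e) e.target) :
    Continuous (mdivergence g Z) := by
  have : FiniteDimensional ℝ E := FiniteDimensional.complexToReal E
  exact continuous_of_charts (E := E) fun e he =>
    ((isMetricOn_formInChart g he).continuousOn_divergence (hZ e he)).congr fun y hy =>
      mdivergence_eq g hZ he hy

/-- Integration by parts for the divergence, with a test function supported in a chart. -/
theorem chartIntegral_mul_mdivergence [T2Space M] [CompactSpace M] [MeasurableSpace E]
    [BorelSpace E] (μ : Measure E) [μ.IsAddHaarMeasure] (g : Metric E M)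
    {Z : ∀ x : M, TangentSpace 𝓘(ℝ, E) x}
    (hZ : ∀ e ∈ atlas E M, ContDiffOn ℝ 1 (vecInChart Z e) e.target)
    {e : OpenPartialHomeomorph M E} (he : e ∈ atlas E M) {ρ : M → ℝ}
    (hρ : ContMDiff 𝓘(ℝ, E) 𝓘(ℝ, ℝ) 1 ρ) (hs : tsupport ρ ⊆ e.source) :
    chartIntegral μ g e (fun x => ρ x * mdivergence g Z x) =
      -chartIntegral μ g e (dirDeriv ρ Z) := by
  have : FiniteDimensional ℝ E := FiniteDimensional.complexToReal E
  obtain ⟨h1, h2⟩ := tsupport_pullToChart hs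
  have hψ : ContDiff ℝ 1 (pullToChart e ρ) := contDiff_of_tsupport_subset
    ((contDiffOn_comp_symm he hρ).congr (pullToChart_eqOn e ρ)) e.open_target h2
  have key := integral_mul_divergence μ (isMetricOn_formInChart g he) (hZ e he) hψ h1 h2
  have e1 : (fun y => pullToChart e ρ y * divergence (formInChart g.inner e) (vecInChart Z e) y *
      density (formInChart g.inner e) y) = fun y =>
      pullToChart e (fun x => ρ x * mdivergence g Z x) y * density (formInChart g.inner e) y := by
    ext y
    by_cases hy : y ∈ e.target
    · simp [pullToChart, hy, mdivergence_eq g hZ he hy]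
    · simp [pullToChart, hy]
  have e2 : (fun y => fderiv ℝ (pullToChart e ρ) y (vecInChart Z e y) *
      density (formInChart g.inner e) y) = fun y =>
      pullToChart e (dirDeriv ρ Z) y * density (formInChart g.inner e) y := by
    ext y
    by_cases hy : y ∈ e.target
    · have h3 : pullToChart e ρ =ᶠ[nhds y] fun y => ρ (e.symm y) :=
        (pullToChart_eqOn e ρ).eventuallyEq_of_mem (e.open_target.mem_nhds hy)
      rw [h3.fderiv_eq, fderiv_comp_symm_vecInChart he hy (hρ.mdifferentiableAt (by simp)),
        pullToChart_eqOn e _ hy]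
    · have h4 : fderiv ℝ (pullToChart e ρ) y = 0 :=
        Function.notMem_support.1 fun h => hy (h2 (support_fderiv_subset ℝ h))
      rw [h4, pullToChart, Set.indicator_of_notMem hy]
      simp
  rw [e1, e2] at key
  exact key

/-- On a compact Riemannian manifold, a vector field with nonnegative divergence is divergence-free.
This follows from the divergence theorem, which is proved by means of a partition of unity. -/
theorem mdivergence_eq_zero_of_nonneg [T2Space M] [CompactSpace M] (g : Metric E M)
    {Z : ∀ x : M, TangentSpace 𝓘(ℝ, E) x}
    (hZ : ∀ e ∈ atlas E M, ContDiffOn ℝ 1 (vecInChart Z e) e.target)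
    (h : ∀ x, 0 ≤ mdivergence g Z x) (x : M) : mdivergence g Z x = 0 := by
  have : FiniteDimensional ℝ E := FiniteDimensional.complexToReal E
  borelize E
  let μ : Measure E := Measure.addHaar
  obtain ⟨t, ht⟩ := isCompact_univ.elim_finite_subcover (fun x : M => (chartAt E x).source)
    (fun x => (chartAt E x).open_source) fun x _ => Set.mem_iUnion.2 ⟨x, mem_chart_source E x⟩
  obtain ⟨ρ, hρ⟩ := SmoothPartitionOfUnity.exists_isSubordinate 𝓘(ℝ, E) isClosed_univ
    (fun i : t => (chartAt E (i : M)).source) (fun i => (chartAt E (i : M)).open_source)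
    (fun x hx => by simpa using ht hx)
  let e : t → OpenPartialHomeomorph M E := fun i => chartAt E (i : M)
  have he (i) : e i ∈ atlas E M := chart_mem_atlas E _
  have hρs (i) : tsupport (ρ i) ⊆ (e i).source := hρ i
  have hρ1 (i) : ContMDiff 𝓘(ℝ, E) 𝓘(ℝ, ℝ) 1 (ρ i) := (ρ i).contMDiff.of_le (by simp)
  have hsum (x : M) : ∑ i, ρ i x = 1 := by
    rw [← finsum_eq_sum_of_fintype]; exact ρ.sum_eq_one (Set.mem_univ x)
  let q := mdivergence g Z
  have hq : Continuous q := continuous_mdivergence g hZ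
  let r : t → M → ℝ := fun i => dirDeriv (ρ i) Z
  have hr (i) : Continuous (r i) := continuous_dirDeriv (hρ1 i) hZ
  have hrs (i) : tsupport (r i) ⊆ (e i).source := (tsupport_dirDeriv_subset _ _).trans (hρs i)
  have hrsum (x : M) : ∑ i, r i x = 0 := by
    have hx := mem_chart_source E x
    set c := chartAt E x
    have hcx : c.symm (c x) = x := c.left_inv hx
    have hi (i) : r i x = fderiv ℝ (fun y => ρ i (c.symm y)) (c x) (vecInChart Z c (c x)) := by
      rw [fderiv_comp_symm_vecInChart (chart_mem_atlas E x) (c.map_source hx)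
        ((hρ1 i).mdifferentiableAt (by simp)), hcx]
    have hdi (i) : DifferentiableAt ℝ (fun y => ρ i (c.symm y)) (c x) :=
      ((contDiffOn_comp_symm (chart_mem_atlas E x) (hρ1 i)).contDiffAt
        (c.open_target.mem_nhds (c.map_source hx))).differentiableAt (by simp)
    have h0 : fderiv ℝ (fun y => ∑ i, ρ i (c.symm y)) (c x) = 0 := by
      simp only [hsum]; exact fderiv_const_apply _
    rw [fderiv_fun_sum fun i _ => hdi i] at h0
    simp only [hi]
    rw [← sum_apply, h0]
    rfl
  have hprod (i j) : tsupport (fun x => ρ j x * r i x) ⊆ (e i).source ∩ (e j).source := by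
    refine Set.subset_inter ?_ ?_
    · exact (closure_mono (Function.support_mul_subset_right _ _)).trans (hrs i)
    · exact (closure_mono (Function.support_mul_subset_left _ _)).trans (hρs j)
  have hcont (i j) : Continuous (fun x => ρ j x * r i x) := (hρ1 j).continuous.mul (hr i)
  -- the divergence theorem, `∫ div Z = 0`
  have hzero : ∑ i, chartIntegral μ g (e i) (fun x => ρ i x * q x) = 0 := by
    calc ∑ i, chartIntegral μ g (e i) (fun x => ρ i x * q x)
        = -∑ i, chartIntegral μ g (e i) (r i) := by
          rw [← Finset.sum_neg_distrib]
          exact Finset.sum_congr rfl fun i _ =>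
            chartIntegral_mul_mdivergence μ g hZ (he i) (hρ1 i) (hρs i)
      _ = -∑ i, ∑ j, chartIntegral μ g (e i) (fun x => ρ j x * r i x) := by
          congr 1
          refine Finset.sum_congr rfl fun i _ => ?_
          rw [← chartIntegral_sum μ g (he i) _ (fun j _ => hcont i j)
            fun j _ => (hprod i j).trans Set.inter_subset_left]
          congr 1
          ext x
          rw [← Finset.sum_mul, hsum, one_mul]
      _ = -∑ i, ∑ j, chartIntegral μ g (e j) (fun x => ρ j x * r i x) := by
          congr 1
          refine Finset.sum_congr rfl fun i _ => Finset.sum_congr rfl fun j _ => ?_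
          exact chartIntegral_eq μ g (he i) (he j) fun x hx => hprod i j (subset_closure hx)
      _ = -∑ j, chartIntegral μ g (e j) (fun x => ∑ i, ρ j x * r i x) := by
          rw [Finset.sum_comm]
          congr 1
          refine Finset.sum_congr rfl fun j _ => ?_
          rw [chartIntegral_sum μ g (he j) _ (fun i _ => hcont i j)
            fun i _ => (hprod i j).trans Set.inter_subset_right]
      _ = 0 := by
          simp only [← Finset.mul_sum, hrsum, mul_zero]
          simp [chartIntegral, pullToChart]
  have hnn (i) (y : E) :
      0 ≤ pullToChart (e i) (fun x => ρ i x * q x) y * density (formInChart g.inner (e i)) y := by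
    refine mul_nonneg (Set.indicator_nonneg (fun y _ => mul_nonneg (ρ.nonneg i _) (h _)) y)
      (Real.sqrt_nonneg _)
  have hqs (i) : tsupport (fun x => ρ i x * q x) ⊆ (e i).source :=
    (closure_mono (Function.support_mul_subset_left _ _)).trans (hρs i)
  have hqc (i) := continuous_pullToChart_mul g (he i) ((hρ1 i).continuous.mul hq) (hqs i)
  have hvan (i) : chartIntegral μ g (e i) (fun x => ρ i x * q x) = 0 :=
    (Finset.sum_eq_zero_iff_of_nonneg fun i _ => integral_nonneg (hnn i)).1 hzero i
      (Finset.mem_univ i)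
  have hρq (i) : ρ i x * q x = 0 := by
    by_contra hne
    have hx : x ∈ (e i).source := hqs i (subset_closure hne)
    have hpos : 0 < chartIntegral μ g (e i) (fun x => ρ i x * q x) := by
      refine (hqc i).1.integral_pos_of_hasCompactSupport_nonneg_nonzero (x := e i x) (hqc i).2
        (hnn i) ?_
      rw [pullToChart_eqOn _ _ ((e i).map_source hx)]
      refine mul_ne_zero (by simpa only [(e i).left_inv hx] using hne)
        ((isMetricOn_formInChart g (he i)).density_pos ((e i).map_source hx)).ne'
    exact hpos.ne' (hvan i)
  have := Finset.sum_eq_zero fun i (_ : i ∈ Finset.univ) => hρq i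
  rwa [← Finset.sum_mul, hsum, one_mul] at this

end DivergenceOnManifold

/-! ### The Lee form -/

section LeeForm

variable {E : Type*} [NormedAddCommGroup E] [NormedSpace ℂ E]

/-- The sum of `a u (v, w)` over the cyclic permutations of `u`, `v`, `w`, with `i v` in place of
`v`: with `a u = ∂_u G` this is the exterior derivative of the fundamental form `G(i·, ·)`, and with
`a u = α(u) G` it is the wedge product of `α` with the fundamental form. -/
def cyclicI (a : E → E → E → ℝ) (u v w : E) : ℝ :=
  a u (Complex.I • v) w + a v (Complex.I • w) u + a w (Complex.I • u) v

/-- In complex dimension at least two, the wedge product with the fundamental form of a Hermitian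
metric is injective on 1-forms: given `u`, evaluate at `(u, v, i v)` with `v` orthogonal to
`u` and `i u`. -/
theorem eq_zero_of_wedge_eq_zero [FiniteDimensional ℝ E] (hN : 2 < Module.finrank ℝ E)
    {G : E →L[ℝ] E →L[ℝ] ℝ} (hpos : ∀ v, v ≠ 0 → 0 < G v v)
    (hI : ∀ v w, G (Complex.I • v) (Complex.I • w) = G v w) {α : E →L[ℝ] ℝ}
    (h : ∀ u v w, cyclicI (fun u v w => α u * G v w) u v w = 0) : α = 0 := by
  ext u
  let L : E →ₗ[ℝ] ℝ × ℝ := (G.flip u).toLinearMap.prod (G (Complex.I • u)).toLinearMap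
  have hL : LinearMap.ker L ≠ ⊥ := LinearMap.ker_ne_bot_of_finrank_lt (by simpa using hN)
  obtain ⟨v, hv, hv0⟩ := (Submodule.ne_bot_iff _).1 hL
  have hv' : L v = 0 := hv
  have h1 : G v u = 0 := congrArg Prod.fst hv'
  have h2 : G (Complex.I • u) v = 0 := congrArg Prod.snd hv'
  have h3 := h u v (Complex.I • v)
  simp only [cyclicI, I_smul_I_smul, hI, map_neg, neg_apply, h1, h2] at h3
  have h4 : α u * G v v = 0 := by linarith
  simpa [(hpos v hv0).ne'] using h4

theorem fderiv_comp_I {β K : E → E →L[ℝ] E →L[ℝ] ℝ} {y : E} (hK : DifferentiableAt ℝ K y)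
    (h : ∀ᶠ z in nhds y, ∀ u v, β z u v = K z (Complex.I • u) v) (x u v : E) :
    fderiv ℝ β y x u v = fderiv ℝ K y x (Complex.I • u) v := by
  let A : E →L[ℝ] E := Complex.I • ContinuousLinearMap.id ℝ E
  have he : β =ᶠ[nhds y] fun z => (K z).comp A := by
    filter_upwards [h] with z hz
    ext u v
    exact hz u v
  have hd : DifferentiableAt ℝ (fun z => (K z).comp A) y := hK.clm_comp (differentiableAt_const A)
  rw [he.fderiv_eq, ← fderiv_clm_apply₂ hd, ← fderiv_clm_apply₂ hK]
  rfl

/-- If `e^{-2f} G` is Kähler then the fundamental form `Ω` of `G` satisfies `dΩ = 2 df ∧ Ω`. -/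
theorem IsKahlerMetricOn.cyclicI_fderiv {G : E → E →L[ℝ] E →L[ℝ] ℝ} {W : Set E} {f : E → ℝ}
    (hG : IsMetricOn G W) (hf : ContDiffOn ℝ ∞ f W) (hK : IsKahlerMetricOn (conformal G f) W)
    {y : E} (hy : y ∈ W) (u v w : E) :
    cyclicI (fun x => fun v w => fderiv ℝ G y x v w) u v w =
      2 * cyclicI (fun x v w => fderiv ℝ f y x * G y v w) u v w := by
  have h := hK.closed y hy u v w
  simp only [hG.fderiv_conformal hf hy, ← mul_add] at h
  have h2 := (mul_eq_zero.1 h).resolve_left (Real.exp_pos _).ne'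
  simp only [cyclicI]
  linarith

theorem IsKahlerMetricOn.eq_fderiv [FiniteDimensional ℝ E] (hN : 2 < Module.finrank ℝ E)
    {G : E → E →L[ℝ] E →L[ℝ] ℝ} {W : Set E} {f : E → ℝ} (hG : IsMetricOn G W)
    (hf : ContDiffOn ℝ ∞ f W) (hK : IsKahlerMetricOn (conformal G f) W) {y : E} (hy : y ∈ W)
    {α : E →L[ℝ] ℝ} (hα : ∀ u v w, cyclicI (fun x => fun v w => fderiv ℝ G y x v w) u v w =
      2 * cyclicI (fun x v w => α x * G y v w) u v w) : α = fderiv ℝ f y := by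
  rw [← sub_eq_zero]
  refine eq_zero_of_wedge_eq_zero hN (hG.pos y hy) (hK.hermitian_of_conformal hy) fun u v w => ?_
  have h1 := hα u v w
  have h2 := IsKahlerMetricOn.cyclicI_fderiv hG hf hK hy u v w
  simp only [cyclicI, sub_apply] at h1 h2 ⊢
  linarith

variable {M : Type*} [TopologicalSpace M] [ChartedSpace E M] [IsManifold 𝓘(ℂ, E) ω M]

/-- The 1-form `θ` is, in the chart `e` and near each point of its target, the differential of a
function `f` such that `e^{-2f} g` is Kähler. -/
def IsLocallyLee (g : Metric E M) (θ : ∀ x : M, TangentSpace 𝓘(ℝ, E) x →L[ℝ] ℝ) : Prop :=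
  ∀ e ∈ atlas E M, ∀ p ∈ e.target, ∃ (W : Set E) (f : E → ℝ), p ∈ W ∧ W ⊆ e.target ∧
    ContDiffOn ℝ ∞ f W ∧ (∀ y ∈ W, oneFormInChart θ e y = fderiv ℝ f y) ∧
    IsKahlerMetricOn (conformal (formInChart g.inner e) f) W

theorem wedgeOneTwo_fundamentalForm (g : Metric E M) {e : OpenPartialHomeomorph M E}
    (he : e ∈ atlas E M) {y : E} (hy : y ∈ e.target) (α : E →L[ℝ] ℝ) (u v w : E) :
    wedgeOneTwo α (formInChart (fundamentalForm g.inner) e y) u v w =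
      cyclicI (fun x v w => α x * formInChart g.inner e y v w) u v w := by
  simp only [wedgeOneTwo, cyclicI, formInChart_fundamentalForm _ he hy]

variable [FiniteDimensional ℂ E]

/-- The exterior derivative, in a chart, of the fundamental form of `g`. -/
theorem extDerivTwo_fundamentalForm (g : Metric E M) {e : OpenPartialHomeomorph M E}
    (he : e ∈ atlas E M) {y : E} (hy : y ∈ e.target) (u v w : E) :
    extDerivTwo (formInChart (fundamentalForm g.inner) e) y u v w =
      cyclicI (fun x v w => fderiv ℝ (formInChart g.inner e) y x v w) u v w := by
  have h := fderiv_comp_I ((isMetricOn_formInChart g he).differentiableAt hy)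
    (β := formInChart (fundamentalForm g.inner) e) (by
      filter_upwards [e.open_target.mem_nhds hy] with z hz u v using
        formInChart_fundamentalForm _ he hz u v)
  simp only [extDerivTwo, cyclicI, h]

/-- A local conformal Kähler metric, read in a chart. -/
theorem isKahlerMetricOn_of_isKahlerOn (g : Metric E M) {U : Set M} (hU : IsOpen U) {φ : M → ℝ}
    (hφ : ContMDiffOn 𝓘(ℝ, E) 𝓘(ℝ, ℝ) ∞ φ U)
    (hK : IsKahlerOn (fun z => Real.exp (-2 * φ z) • g.inner z) U)
    {e : OpenPartialHomeomorph M E} (he : e ∈ atlas E M) :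
    ContDiffOn ℝ ∞ (fun y => φ (e.symm y)) (e.target ∩ e.symm ⁻¹' U) ∧
      IsKahlerMetricOn (conformal (formInChart g.inner e) fun y => φ (e.symm y))
        (e.target ∩ e.symm ⁻¹' U) := by
  have hf : ContDiffOn ℝ ∞ (fun y => φ (e.symm y)) (e.target ∩ e.symm ⁻¹' U) := by
    rw [← contMDiffOn_iff_contDiffOn]
    exact hφ.comp (((contMDiffOn_symm he).of_le le_top).mono Set.inter_subset_left)
      fun y hy => hy.2
  have hW : IsOpen (e.target ∩ e.symm ⁻¹' U) := e.isOpen_inter_preimage_symm hU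
  have hG := ((isMetricOn_formInChart g he).mono hW Set.inter_subset_left).conformal hf
  refine ⟨hf, hG, fun y hy v w => formInChart_hermitian hK.hermitian he hy.1 hy.2 v w,
    fun y hy u v w => ?_⟩
  have h := fderiv_comp_I (hG.differentiableAt hy)
    (β := formInChart (fundamentalForm fun z => Real.exp (-2 * φ z) • g.inner z) e) (by
      filter_upwards [hW.mem_nhds hy] with z hz u v using
        formInChart_fundamentalForm _ he hz.1 u v)
  have hc := hK.closed e he y hy.1 hy.2 u v w
  simpa only [extDerivTwo, h] using hc

variable (hdim : 2 ≤ Module.finrank ℂ E)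
include hdim

theorem two_lt_finrank_real : 2 < Module.finrank ℝ E := by
  rw [← Module.finrank_mul_finrank ℝ ℂ E, Complex.finrank_real_complex]
  omega

theorem IsLeeForm.isLocallyLee {g : Metric E M} (hg : IsLcK g)
    {θ : ∀ x : M, TangentSpace 𝓘(ℝ, E) x →L[ℝ] ℝ} (hθ : IsLeeForm g θ) : IsLocallyLee g θ := by
  have : FiniteDimensional ℝ E := FiniteDimensional.complexToReal E
  intro e he p hp
  obtain ⟨U, hU, hpU, φ, hφ, hK⟩ := hg.locally_conformal (e.symm p)
  obtain ⟨hf, hKe⟩ := isKahlerMetricOn_of_isKahlerOn g hU hφ hK he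
  refine ⟨e.target ∩ e.symm ⁻¹' U, fun y => φ (e.symm y), ⟨hp, hpU⟩,
    Set.inter_subset_left, hf, fun y hy => ?_, hKe⟩
  refine IsKahlerMetricOn.eq_fderiv (two_lt_finrank_real hdim)
    ((isMetricOn_formInChart g he).mono hKe.isOpen Set.inter_subset_left) hf hKe hy
    fun u v w => ?_
  rw [← extDerivTwo_fundamentalForm g he hy.1, ← wedgeOneTwo_fundamentalForm g he hy.1]
  exact hθ.extDeriv_eq e he y hy.1 u v w

theorem IsLcK.exists_isLocallyLee {g : Metric E M} (hg : IsLcK g) :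
    ∃ θ : ∀ x : M, TangentSpace 𝓘(ℝ, E) x →L[ℝ] ℝ, IsLocallyLee g θ := by
  have : FiniteDimensional ℝ E := FiniteDimensional.complexToReal E
  choose U hU hxU φ hφ hK using hg.locally_conformal
  refine ⟨fun x => (mfderiv 𝓘(ℝ, E) 𝓘(ℝ, ℝ) (φ x) x : E →L[ℝ] ℝ), fun e he p hp => ?_⟩
  obtain ⟨hf, hKe⟩ := isKahlerMetricOn_of_isKahlerOn g (hU (e.symm p)) (hφ _) (hK _) he
  refine ⟨e.target ∩ e.symm ⁻¹' U (e.symm p), fun y => φ (e.symm p) (e.symm y), ⟨hp, hxU _⟩,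
    Set.inter_subset_left, hf, fun y hy => ?_, hKe⟩
  -- the local functions chosen at two different points have the same differential
  set x := e.symm y
  obtain ⟨hf', hKe'⟩ := isKahlerMetricOn_of_isKahlerOn g (hU x) (hφ x) (hK x) he
  have hy' : y ∈ e.target ∩ e.symm ⁻¹' U x := ⟨hy.1, hxU x⟩
  have hG := isMetricOn_formInChart g he
  have h1 := IsKahlerMetricOn.eq_fderiv (two_lt_finrank_real hdim)
    (hG.mono hKe.isOpen Set.inter_subset_left) hf hKe hy
    (IsKahlerMetricOn.cyclicI_fderiv (hG.mono hKe'.isOpen Set.inter_subset_left) hf' hKe' hy')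
  rw [← h1]
  ext v
  have hd : MDifferentiableAt 𝓘(ℝ, E) 𝓘(ℝ, ℝ) (φ x) (e.symm y) :=
    ((hφ x).contMDiffAt ((hU x).mem_nhds (hxU x))).mdifferentiableAt (by simp)
  exact (fderiv_comp_symm he hy.1 hd v).symm

end LeeForm

/-! ### Vanishing of the Lee form -/

section Vanishing

theorem divergence_congr {E : Type*} [NormedAddCommGroup E] [NormedSpace ℝ E]
    {G : E → E →L[ℝ] E →L[ℝ] ℝ} {Z Z' : E → E} {y : E} (h : Z =ᶠ[nhds y] Z') :
    divergence G Z y = divergence G Z' y := by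
  rw [divergence, divergence, covDeriv, covDeriv, h.fderiv_eq, h.eq_of_nhds]

theorem divergence_smul {E : Type*} [NormedAddCommGroup E] [NormedSpace ℝ E]
    [FiniteDimensional ℝ E] {G : E → E →L[ℝ] E →L[ℝ] ℝ} {h : E → ℝ} {Z : E → E} {y : E}
    (hh : DifferentiableAt ℝ h y) (hZ : DifferentiableAt ℝ Z y) :
    divergence G (fun z => h z • Z z) y = h y * divergence G Z y + fderiv ℝ h y (Z y) := by
  have hd := hh.hasFDerivAt.fun_smul hZ.hasFDerivAt
  have h1 : (covDeriv G (fun z => h z • Z z) y).toLinearMap =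
      h y • (covDeriv G Z y).toLinearMap + (fderiv ℝ h y).toLinearMap.smulRight (Z y) := by
    ext v
    simp [covDeriv_apply, hd.fderiv]
    abel
  rw [divergence, h1, map_add, map_smul, LinearMap.trace_smulRight]
  rfl

theorem scalar_eq {E : Type*} [NormedAddCommGroup E] [NormedSpace ℝ E] [FiniteDimensional ℝ E]
    {G : E → E →L[ℝ] E →L[ℝ] ℝ} {W : Set E}
    (hG : IsMetricOn G W) {y : E} (hy : y ∈ W) {c : ℝ}
    (h : ∀ v w, ricci G y v w = c * G y v w) : scalar G y = c * Module.finrank ℝ E := by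
  have h1 : (G y).inverse.toLinearMap ∘ₗ (LinearMap.toContinuousLinearMap (𝕜 := ℝ) (E := E)
      (F' := ℝ)) ∘ₗ ricci G y = c • LinearMap.id := by
    ext v
    have h2 : LinearMap.toContinuousLinearMap (ricci G y v) = c • G y v := by
      ext w; exact h v w
    simp only [LinearMap.comp_apply, LinearEquiv.coe_coe, h2, ContinuousLinearMap.coe_coe, map_smul,
      (hG.isInvertible hy).inverse_apply_self]
    rfl
  rw [scalar, h1, map_smul, LinearMap.trace_id, smul_eq_mul]

theorem contDiff_posPart_sq : ContDiff ℝ 1 (fun t : ℝ => max t 0 ^ 2) ∧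
    ∀ t : ℝ, deriv (fun t : ℝ => max t 0 ^ 2) t = 2 * max t 0 := by
  have h (t : ℝ) : HasDerivAt (fun t : ℝ => max t 0 ^ 2) (2 * max t 0) t := by
    rcases lt_trichotomy t 0 with ht | rfl | ht
    · have he : (fun t : ℝ => max t 0 ^ 2) =ᶠ[nhds t] fun _ => 0 := by
        filter_upwards [gt_mem_nhds ht] with s hs
        simp [max_eq_right (le_of_lt hs)]
      rw [max_eq_right ht.le, mul_zero]
      exact (hasDerivAt_const t (0 : ℝ)).congr_of_eventuallyEq he
    · rw [max_self, mul_zero, hasDerivAt_iff_isLittleO_nhds_zero]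
      simp only [zero_add, max_self, smul_zero, sub_zero, ne_eq, OfNat.ofNat_ne_zero,
        not_false_eq_true, zero_pow]
      have h1 : (fun t : ℝ => max t 0 ^ 2) =O[nhds 0] fun t : ℝ => t ^ 2 := by
        refine Asymptotics.isBigO_of_le _ fun t => ?_
        rcases le_total t 0 with ht | ht
        · simp [max_eq_right ht]; positivity
        · simp [max_eq_left ht]
      refine h1.trans_isLittleO ?_
      simpa using Asymptotics.isLittleO_pow_id (𝕜 := ℝ) (n := 2) (by norm_num)
    · have he : (fun t : ℝ => max t 0 ^ 2) =ᶠ[nhds t] fun t => t ^ 2 := by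
        filter_upwards [lt_mem_nhds ht] with s hs
        simp [max_eq_left (le_of_lt hs)]
      rw [max_eq_left ht.le]
      simpa using (hasDerivAt_pow 2 t).congr_of_eventuallyEq he
  have hd : deriv (fun t : ℝ => max t 0 ^ 2) = fun t => 2 * max t 0 := by
    ext t; exact (h t).deriv
  refine ⟨contDiff_one_iff_deriv.2 ⟨fun t => (h t).differentiableAt, ?_⟩, fun t => (h t).deriv⟩
  rw [hd]
  fun_prop

variable {E : Type*} [NormedAddCommGroup E] [NormedSpace ℂ E]
variable {M : Type*} [TopologicalSpace M] [ChartedSpace E M] [IsManifold 𝓘(ℂ, E) ω M]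

/-- The vector field dual to the 1-form `θ` with respect to the metric `g`. -/
def dualField (g : Metric E M) (θ : ∀ x : M, TangentSpace 𝓘(ℝ, E) x →L[ℝ] ℝ) (x : M) :
    TangentSpace 𝓘(ℝ, E) x :=
  ((g.inner x : E →L[ℝ] E →L[ℝ] ℝ).inverse (θ x : E →L[ℝ] ℝ) : E)

/-- The squared norm of the 1-form `θ`. -/
def normSq (g : Metric E M) (θ : ∀ x : M, TangentSpace 𝓘(ℝ, E) x →L[ℝ] ℝ) (x : M) : ℝ :=
  (θ x : E →L[ℝ] ℝ) (dualField g θ x)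

/-- The function `|θ|² - div θ`. -/
def leePotential (g : Metric E M) (θ : ∀ x : M, TangentSpace 𝓘(ℝ, E) x →L[ℝ] ℝ) (x : M) : ℝ :=
  normSq g θ x - mdivergence g (dualField g θ) x

theorem normSq_comp_symm (g : Metric E M) (θ : ∀ x : M, TangentSpace 𝓘(ℝ, E) x →L[ℝ] ℝ)
    {e : OpenPartialHomeomorph M E} (he : e ∈ atlas E M) {y : E} (hy : y ∈ e.target) :
    normSq g θ (e.symm y) = oneFormInChart θ e y (vecInChart (dualField g θ) e y) := by
  rw [oneFormInChart_eq, symmDeriv_vecInChart he _ hy, normSq]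

variable [FiniteDimensional ℂ E]

theorem inner_dualField (g : Metric E M) (θ : ∀ x : M, TangentSpace 𝓘(ℝ, E) x →L[ℝ] ℝ) (x : M)
    (v : E) : (g.inner x : E →L[ℝ] E →L[ℝ] ℝ) (dualField g θ x) v = (θ x : E →L[ℝ] ℝ) v := by
  have : FiniteDimensional ℝ E := FiniteDimensional.complexToReal E
  have hm : IsMetricOn (fun _ : E => (g.inner x : E →L[ℝ] E →L[ℝ] ℝ)) Set.univ :=
    ⟨isOpen_univ, contDiffOn_const, fun _ _ v w => g.symm x v w, fun _ _ v hv => g.pos x v hv⟩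
  exact congrArg (fun L : E →L[ℝ] ℝ => L v) (hm.apply_inverse (Set.mem_univ 0) (θ x : E →L[ℝ] ℝ))

theorem normSq_eq (g : Metric E M) (θ : ∀ x : M, TangentSpace 𝓘(ℝ, E) x →L[ℝ] ℝ) (x : M) :
    normSq g θ x = g.inner x (dualField g θ x) (dualField g θ x) :=
  (inner_dualField g θ x (dualField g θ x)).symm

theorem normSq_nonneg (g : Metric E M) (θ : ∀ x : M, TangentSpace 𝓘(ℝ, E) x →L[ℝ] ℝ) (x : M) :
    0 ≤ normSq g θ x := by
  rw [normSq_eq]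
  by_cases h : dualField g θ x = 0
  · simp [h]
  · exact (g.pos x _ h).le

theorem eq_zero_of_normSq_eq_zero {g : Metric E M} {θ : ∀ x : M, TangentSpace 𝓘(ℝ, E) x →L[ℝ] ℝ}
    {x : M} (hx : normSq g θ x = 0) : θ x = 0 := by
  have h : dualField g θ x = 0 := by
    by_contra h
    rw [normSq_eq] at hx
    exact (g.pos x _ h).ne' hx
  ext v
  have := inner_dualField g θ x v
  rw [h] at this
  simpa using this.symm

theorem vecInChart_dualField (g : Metric E M) (θ : ∀ x : M, TangentSpace 𝓘(ℝ, E) x →L[ℝ] ℝ)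
    {e : OpenPartialHomeomorph M E} (he : e ∈ atlas E M) {y : E} (hy : y ∈ e.target) :
    vecInChart (dualField g θ) e y = sharp (formInChart g.inner e) (oneFormInChart θ e) y := by
  have : FiniteDimensional ℝ E := FiniteDimensional.complexToReal E
  have hG := isMetricOn_formInChart g he
  refine hG.eq_of_forall hy fun v => ?_
  rw [hG.apply_sharp hy, formInChart_eq, symmDeriv_vecInChart he _ hy, inner_dualField,
    oneFormInChart_eq]

section

variable {g : Metric E M} {θ : ∀ x : M, TangentSpace 𝓘(ℝ, E) x →L[ℝ] ℝ} (hθ : IsLocallyLee g θ)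
  {e : OpenPartialHomeomorph M E} (he : e ∈ atlas E M)
include hθ he

theorem IsLocallyLee.contDiffOn_vecInChart :
    ContDiffOn ℝ ∞ (vecInChart (dualField g θ) e) e.target := by
  have : FiniteDimensional ℝ E := FiniteDimensional.complexToReal E
  have hΘ : ContDiffOn ℝ ∞ (oneFormInChart θ e) e.target := by
    intro p hp
    obtain ⟨W, f, hpW, hW, hf, hθf, hK⟩ := hθ e he p hp
    have h1 : ContDiffOn ℝ ∞ (fderiv ℝ f) W := hf.fderiv_of_isOpen hK.isOpen (by simp)
    exact ((h1.congr hθf).contDiffAt (hK.isOpen.mem_nhds hpW)).contDiffWithinAt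
  exact ((isMetricOn_formInChart g he).contDiffOn_sharp hΘ).congr
    fun y hy => vecInChart_dualField g θ he hy

end

/-- The differential equation of `fderiv_normSq_sub_divergence`, for the function
`|θ|² - div θ` on `M`. -/
theorem IsLocallyLee.leePotential {g : Metric E M}
    {θ : ∀ x : M, TangentSpace 𝓘(ℝ, E) x →L[ℝ] ℝ} (hθ : IsLocallyLee g θ)
    (hN : 2 < Module.finrank ℝ E) {c : ℝ}
    (hc : ∀ e ∈ atlas E M, ∀ y ∈ e.target, ∀ v w : E,
      ricci (formInChart g.inner e) y v w = c * formInChart g.inner e y v w)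
    {e : OpenPartialHomeomorph M E} (he : e ∈ atlas E M) {p : E} (hp : p ∈ e.target) :
    ContDiffAt ℝ 1 (fun y => leePotential g θ (e.symm y)) p ∧
      ∀ z, fderiv ℝ (fun y => leePotential g θ (e.symm y)) p z =
        -(3 * leePotential g θ (e.symm p) - 2 * c
          + (Module.finrank ℝ E - 4) * normSq g θ (e.symm p)) * oneFormInChart θ e p z := by
  have : FiniteDimensional ℝ E := FiniteDimensional.complexToReal E
  obtain ⟨W, f, hpW, hW, hf, hθf, hK⟩ := hθ e he p hp
  have hG := (isMetricOn_formInChart g he).mono hK.isOpen hW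
  set G := formInChart g.inner e
  have hX : ∀ y ∈ W, vecInChart (dualField g θ) e y = sharp G (fderiv ℝ f) y := by
    intro y hy
    rw [vecInChart_dualField g θ he (hW hy), sharp, sharp, hθf y hy]
  have hF : ∀ y ∈ W, normSq g θ (e.symm y) = fderiv ℝ f y (sharp G (fderiv ℝ f) y) := by
    intro y hy
    rw [normSq_comp_symm g θ he (hW hy), hX y hy, hθf y hy]
  have hP : ∀ y ∈ W, LcK.leePotential g θ (e.symm y) =
      fderiv ℝ f y (sharp G (fderiv ℝ f) y) - divergence G (sharp G (fderiv ℝ f)) y := by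
    intro y hy
    rw [LcK.leePotential, hF y hy, mdivergence_eq g
      (fun e he => (hθ.contDiffOn_vecInChart he).of_le (by simp)) he (hW hy)]
    congr 1
    apply divergence_congr
    filter_upwards [hK.isOpen.mem_nhds hy] with z hz using hX z hz
  have he' : (fun y => LcK.leePotential g θ (e.symm y)) =ᶠ[nhds p] fun y =>
      fderiv ℝ f y (sharp G (fderiv ℝ f) y) - divergence G (sharp G (fderiv ℝ f)) y := by
    filter_upwards [hK.isOpen.mem_nhds hpW] with y hy using hP y hy
  constructor
  · have h1 : ContDiffOn ℝ ∞ (fderiv ℝ f) W := hf.fderiv_of_isOpen hK.isOpen (by simp)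
    have h2 := hG.contDiffOn_sharp h1
    have h3 := (h1.clm_apply h2).sub (contDiffOn_trace (hG.contDiffOn_covDeriv h2))
    exact ((h3.contDiffAt (hK.isOpen.mem_nhds hpW)).of_le (by simp)).congr_of_eventuallyEq he'
  · intro z
    rw [he'.fderiv_eq, hP p hpW, hF p hpW, hθf p hpW]
    exact fderiv_normSq_sub_divergence hG hf hK (fun y hy => hc e he y (hW hy)) hN hpW z

/-- For a function `ψ` of one variable, the divergence of `ψ(P) X`, where `X` is dual to `θ` and
`P = |θ|² - div θ`. -/
theorem IsLocallyLee.mdivergence_smul {g : Metric E M}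
    {θ : ∀ x : M, TangentSpace 𝓘(ℝ, E) x →L[ℝ] ℝ} (hθ : IsLocallyLee g θ)
    (hN : 2 < Module.finrank ℝ E) {c : ℝ}
    (hc : ∀ e ∈ atlas E M, ∀ y ∈ e.target, ∀ v w : E,
      ricci (formInChart g.inner e) y v w = c * formInChart g.inner e y v w)
    {ψ : ℝ → ℝ} (hψ : ContDiff ℝ 1 ψ) :
    let P := LcK.leePotential g θ
    let F := normSq g θ
    let Z : ∀ x : M, TangentSpace 𝓘(ℝ, E) x := fun x => ψ (P x) • dualField g θ x
    (∀ e ∈ atlas E M, ContDiffOn ℝ 1 (vecInChart Z e) e.target) ∧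
      ∀ x, mdivergence g Z x = ψ (P x) * (F x - P x)
        - deriv ψ (P x) * (3 * P x - 2 * c + (Module.finrank ℝ E - 4) * F x) * F x := by
  intro P F Z
  have : FiniteDimensional ℝ E := FiniteDimensional.complexToReal E
  have hX {e : OpenPartialHomeomorph M E} (he : e ∈ atlas E M) :
      ContDiffOn ℝ 1 (vecInChart (dualField g θ) e) e.target :=
    (hθ.contDiffOn_vecInChart he).of_le (by simp)
  have hP {e : OpenPartialHomeomorph M E} (he : e ∈ atlas E M) :
      ContDiffOn ℝ 1 (fun y => P (e.symm y)) e.target :=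
    fun y hy => (hθ.leePotential hN hc he hy).1.contDiffWithinAt
  have hZe (e : OpenPartialHomeomorph M E) :
      vecInChart Z e = fun y => ψ (P (e.symm y)) • vecInChart (dualField g θ) e y := by
    ext y
    exact map_smul (symmDeriv e y).inverse (ψ (P (e.symm y))) (dualField g θ (e.symm y) : E)
  have hZ : ∀ e ∈ atlas E M, ContDiffOn ℝ 1 (vecInChart Z e) e.target := by
    intro e he
    rw [hZe]
    exact (hψ.comp_contDiffOn (hP he)).smul (hX he)
  refine ⟨hZ, fun x => ?_⟩
  set e := chartAt E x
  have he : e ∈ atlas E M := chart_mem_atlas E x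
  have hy : e x ∈ e.target := e.map_source (mem_chart_source E x)
  have hx : e.symm (e x) = x := e.left_inv (mem_chart_source E x)
  have hnhds := e.open_target.mem_nhds hy
  have hdX := ((hX he).contDiffAt hnhds).differentiableAt (by simp)
  have hdP := ((hP he).contDiffAt hnhds).differentiableAt (by simp)
  have hdψ : HasFDerivAt (fun y => ψ (P (e.symm y))) (deriv ψ (P (e.symm (e x))) •
      fderiv ℝ (fun y => P (e.symm y)) (e x)) (e x) :=
    ((hψ.differentiable (by simp) _).hasDerivAt).comp_hasFDerivAt (e x) hdP.hasFDerivAt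
  have h1 := mdivergence_eq g hZ he hy
  rw [hZe, divergence_smul hdψ.differentiableAt hdX, hdψ.fderiv, smul_apply,
    (hθ.leePotential hN hc he hy).2, ← normSq_comp_symm g θ he hy,
    ← mdivergence_eq g (fun e he => hX he) he hy, hx] at h1
  rw [h1]
  have h2 : mdivergence g (dualField g θ) x = F x - P x := by
    simp only [F, P, LcK.leePotential]; ring
  rw [h2, smul_eq_mul]
  ring

/-- If `g` is Einstein with nonpositive Einstein constant, and locally conformally Kähler, then the
Lee form vanishes: the divergence theorem applied to `P₊² X`, where `P = |θ|² - div X`, gives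
`P ≤ 0`; applied to `X` itself it then gives `θ = 0`. -/
theorem IsLocallyLee.eq_zero [T2Space M] [CompactSpace M] {g : Metric E M}
    {θ : ∀ x : M, TangentSpace 𝓘(ℝ, E) x →L[ℝ] ℝ} (hθ : IsLocallyLee g θ)
    (hN : 4 ≤ Module.finrank ℝ E) {c : ℝ} (hc0 : c ≤ 0)
    (hc : ∀ e ∈ atlas E M, ∀ y ∈ e.target, ∀ v w : E,
      ricci (formInChart g.inner e) y v w = c * formInChart g.inner e y v w) : θ = 0 := by
  have hN2 : 2 < Module.finrank ℝ E := by omega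
  have hN4 : (0 : ℝ) ≤ (Module.finrank ℝ E : ℝ) - 4 := by
    have : (4 : ℝ) ≤ Module.finrank ℝ E := by exact_mod_cast hN
    linarith
  have hF := normSq_nonneg g θ
  have hP (x : M) : LcK.leePotential g θ x ≤ 0 := by
    obtain ⟨hψ, hψ'⟩ := contDiff_posPart_sq
    obtain ⟨hZ, hdiv⟩ := hθ.mdivergence_smul hN2 hc hψ.neg
    have hd (t : ℝ) : deriv (fun t : ℝ => -max t 0 ^ 2) t = -(2 * max t 0) := by
      rw [deriv.fun_neg, hψ']
    -- with `p = max P 0` one has `P p = p²`, and the divergence is a sum of nonnegative terms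
    have hsum (x : M) : mdivergence g (fun x => (-max (LcK.leePotential g θ x) 0 ^ 2) •
        dualField g θ x) x = max (LcK.leePotential g θ x) 0 ^ 3
          + (5 * (max (LcK.leePotential g θ x) 0 ^ 2 * normSq g θ x)
          + 4 * (-c * (max (LcK.leePotential g θ x) 0 * normSq g θ x))
          + 2 * ((Module.finrank ℝ E - 4) * (max (LcK.leePotential g θ x) 0
            * normSq g θ x ^ 2))) := by
      rw [hdiv x, hd]
      have hp : LcK.leePotential g θ x * max (LcK.leePotential g θ x) 0 =
          max (LcK.leePotential g θ x) 0 ^ 2 := by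
        rcases le_total (LcK.leePotential g θ x) 0 with h | h
        · simp [max_eq_right h]
        · rw [max_eq_left h]; ring
      set p := max (LcK.leePotential g θ x) 0
      linear_combination (p + 6 * normSq g θ x) * hp
    have hrest (x : M) : 0 ≤ 5 * (max (LcK.leePotential g θ x) 0 ^ 2 * normSq g θ x)
          + 4 * (-c * (max (LcK.leePotential g θ x) 0 * normSq g θ x))
          + 2 * ((Module.finrank ℝ E - 4) * (max (LcK.leePotential g θ x) 0
            * normSq g θ x ^ 2)) := by
      have h1 : 0 ≤ max (LcK.leePotential g θ x) 0 := le_max_right _ _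
      have h2 := hF x
      have h3 : 0 ≤ -c := by linarith
      positivity
    have hzero := mdivergence_eq_zero_of_nonneg g hZ (fun x => by
      have h1 : 0 ≤ max (LcK.leePotential g θ x) 0 ^ 3 := pow_nonneg (le_max_right _ _) 3
      exact (add_nonneg h1 (hrest x)).trans_eq (hsum x).symm) x
    have h2 : max (LcK.leePotential g θ x) 0 ^ 3 ≤ 0 := by
      have := (hsum x).symm.trans hzero
      linarith [hrest x]
    by_contra h
    push Not at h
    rw [max_eq_left h.le] at h2
    exact absurd h2 (not_le.2 (pow_pos h 3))
  funext x
  obtain ⟨hZ, hdiv⟩ := hθ.mdivergence_smul hN2 hc (ψ := fun _ => 1) contDiff_const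
  have hval (x : M) : mdivergence g (fun x => (1 : ℝ) • dualField g θ x) x =
      normSq g θ x - LcK.leePotential g θ x := by
    rw [hdiv x]; simp
  have hzero := mdivergence_eq_zero_of_nonneg g hZ (fun x => by
    have := hF x
    have := hP x
    refine (?_ : (0 : ℝ) ≤ _).trans_eq (hval x).symm
    linarith) x
  have h1 := (hval x).symm.trans hzero
  exact eq_zero_of_normSq_eq_zero (le_antisymm (by linarith [hP x]) (hF x))

theorem IsLocallyLee.isKahler {g : Metric E M} (hg : IsLcK g)
    {θ : ∀ x : M, TangentSpace 𝓘(ℝ, E) x →L[ℝ] ℝ} (hθ : IsLocallyLee g θ) (h0 : θ = 0) :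
    IsKahler g := by
  refine ⟨hg.hermitian, fun e he y hy _ u v w => ?_⟩
  obtain ⟨W, f, hyW, hW, hf, hθf, hK⟩ := hθ e he y hy
  have hdf (v : E) : fderiv ℝ f y v = 0 := by
    rw [← hθf y hyW, h0]; rfl
  rw [extDerivTwo_fundamentalForm g he hy, IsKahlerMetricOn.cyclicI_fderiv
    ((isMetricOn_formInChart g he).mono hK.isOpen hW) hf hK hyW]
  simp [cyclicI, hdf]

end Vanishing

end LcK

end

theorem mainTheorem5 {E : Type*} [NormedAddCommGroup E] [NormedSpace ℂ E] [FiniteDimensional ℂ E]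
    (hdim : 2 ≤ Module.finrank ℂ E)
    {M : Type*} [TopologicalSpace M] [T2Space M] [CompactSpace M] [ConnectedSpace M]
    [ChartedSpace E M] [IsManifold 𝓘(ℂ, E) ω M]
    (g : LcK.Metric E M) (hg : LcK.IsLcK g) (hE : LcK.IsEinstein g)
    (hs : ∀ x : M, LcK.scalarCurvature g x ≤ 0) :
    (∀ θ : (∀ x : M, TangentSpace 𝓘(ℝ, E) x →L[ℝ] ℝ), LcK.IsLeeForm g θ → θ = 0) ∧
      LcK.IsKahler g ∧ LcK.IsEinstein g := by
  have : FiniteDimensional ℝ E := FiniteDimensional.complexToReal E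
  have hN : 4 ≤ Module.finrank ℝ E := by
    rw [← Module.finrank_mul_finrank ℝ ℂ E, Complex.finrank_real_complex]
    omega
  obtain ⟨c, hc⟩ := id hE
  have hc0 : c ≤ 0 := by
    obtain ⟨x⟩ : Nonempty M := inferInstance
    have hx := mem_chart_source E x
    have h1 := hs x
    rw [LcK.scalarCurvature, LcK.scalar_eq
      (LcK.isMetricOn_formInChart g (chart_mem_atlas E x)) ((chartAt E x).map_source hx)
      (hc _ (chart_mem_atlas E x) _ ((chartAt E x).map_source hx))] at h1
    have h2 : (0 : ℝ) < Module.finrank ℝ E := by exact_mod_cast (by omega)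
    exact nonpos_of_mul_nonpos_left h1 h2
  obtain ⟨θ, hθ⟩ := hg.exists_isLocallyLee hdim
  exact ⟨fun θ hθ => (hθ.isLocallyLee hdim hg).eq_zero hN hc0 hc,
    hθ.isKahler hg (hθ.eq_zero hN hc0 hc), hE⟩
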